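/- Let $A,B$ be finite-dimensional quantum systems, $R\cong A$, let $\mathcal{W}_{A\to B}$ be a quantum channel (a completely positive trace-preserving linear map) with Choi matrix $(J_{\mathcal W})_{RB}=\sum_{i,j=1}^{|A|}|i\rangle\langle j|_R\otimes \mathcal{W}(|i\rangle\langle j|_A)$, and let $M\ge 1$ be an integer. Write $\mathcal{S}(\cdot)$ for the set of density operators of a system, $X\wedge Y:=\frac12(X+Y-|X-Y|)$ for Hermitian $X,Y$, $\mathcal{I}_2(X):=\sum_{i=1}^2\langle i|X|i\rangle\,|i\rangle\langle i|$ for the noiseless classical bit channel, and $$D_H^{\varepsilon}(\rho\|\sigma):=-\log\min\{\mathrm{Tr}[\sigma O] : 0\preccurlyeq O\preccurlyeq \mathbb{I},\ \mathrm{Tr}[\rho O]\ge 1-\varepsilon\}.$$ For an integer $N\ge1$ and a channel $\mathcal{V}_{A'\to B'}$, a non-signaling code for $N$ messages is a bipartite quantum channel $\Pi$ with input systems $A_i,B_i$ and output systems $A_o,B_o$, where $A_i,B_o\cong\mathbb{C}^N$, $A_o=A'$, $B_i=B'$, given by a Choi matrix $J_{A_iA_oB_iB_o}\succcurlyeq 0$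 with $J_{A_iB_i}=\mathbb{I}_{A_iB_i}$, such that $J_{A_iB_iB_o}=\mathbb{I}_{A_i}\otimes K_{B_iB_o}$ and $J_{A_iA_oB_i}=K'_{A_iA_o}\otimes \mathbb{I}_{B_i}$ for some matrices $K,K'$ (subscripts of $J$ denote marginals). Let $\Pi(\mathcal{V}):A_i\to B_o$ be the effective channel obtained by connecting $A_o$ to $B_i$ through $\mathcal{V}$, and define $\varepsilon^{\rm NS}(N,\mathcal{V})$ by $$1-\varepsilon^{\rm NS}(N,\mathcal{V}):=\sup_{\Pi}\ \frac1N\sum_{m=1}^N\langle m|\,\Pi(\mathcal{V})(|m\rangle\langle m|)\,|m\rangle ,$$ the supremum being over all non-signaling codes for $N$ messages. Define the meta-converse error probability by $$\varepsilon^{\rm MC}(M,\mathcal{W}):=\inf\Big\{\varepsilon\in[0,1] : \sup_{\rho_R\in\mathcal{S}(R)}\inf_{\sigma_B\in\mathcal{S}(B)}D_H^{\varepsilon}\big(\sqrt{\rho_R}\,(J_{\mathcal W})_{RB}\sqrt{\rho_R}\,\big\|\,\rho_R\otimes\sigma_B\big)\ge\log M\Big\}.$$ Then $$\varepsilon^{\rm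 NS}(2M,\mathcal{W}\otimes\mathcal{I}_2)=\varepsilon^{\rm MC}(M,\mathcal{W})=\inf_{\rho_R\in\mathcal{S}(R)}\ \sup_{Z_B\succcurlyeq0}\Big\{\mathrm{Tr}\big[\sqrt{\rho_R}\,(J_{\mathcal W})_{RB}\sqrt{\rho_R}\wedge M\,\rho_R\otimes Z_B\big]-\mathrm{Tr}[Z_B]\Big\}.$$ -/

import Mathlib

open scoped MatrixOrder ComplexOrder Kronecker

noncomputable section

namespace NSCoding

variable {a b c d x y : Type*}

/-! ### States, channels and Choi matrices -/

/-- Density operators (quantum states) on `ℂ^a`. -/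
def IsState [Fintype a] (ρ : Matrix a a ℂ) : Prop :=
  ρ.PosSemidef ∧ ρ.trace = 1

/-- The ampliation `id_k ⊗ Φ`, which applies `Φ` to every `a × a` block. -/
def ampliation (k : ℕ) (Φ : Matrix a a ℂ →ₗ[ℂ] Matrix b b ℂ)
    (X : Matrix (Fin k × a) (Fin k × a) ℂ) : Matrix (Fin k × b) (Fin k × b) ℂ :=
  Matrix.of fun p q => Φ (Matrix.of fun s t => X (p.1, s) (q.1, t)) p.2 q.2

/-- A quantum channel: a completely positive and trace-preserving linear map. -/
structure IsQuantumChannel [Fintype a] [Fintype b]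
    (Φ : Matrix a a ℂ →ₗ[ℂ] Matrix b b ℂ) : Prop where
  completelyPositive : ∀ (k : ℕ) (X : Matrix (Fin k × a) (Fin k × a) ℂ),
    X.PosSemidef → (ampliation k Φ X).PosSemidef
  tracePreserving : ∀ X : Matrix a a ℂ, (Φ X).trace = X.trace

/-- The (unnormalized) Choi matrix `∑ i j, |i⟩⟨j| ⊗ Φ(|i⟩⟨j|)`. -/
def choi [Fintype a] [DecidableEq a] (Φ : Matrix a a ℂ →ₗ[ℂ] Matrix b b ℂ) :
    Matrix (a × b) (a × b) ℂ :=
  ∑ i, ∑ j, Matrix.single i j (1 : ℂ) ⊗ₖ Φ (Matrix.single i j 1)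

/-- The tensor product `Φ ⊗ Ψ` of two linear maps on matrices: the linear map with
`(Φ ⊗ Ψ)(|i⟩⟨j| ⊗ |k⟩⟨l|) = Φ(|i⟩⟨j|) ⊗ Ψ(|k⟩⟨l|)`. -/
def tensorMap [Fintype a] [Fintype c] [DecidableEq a] [DecidableEq c]
    (Φ : Matrix a a ℂ →ₗ[ℂ] Matrix b b ℂ) (Ψ : Matrix c c ℂ →ₗ[ℂ] Matrix d d ℂ) :
    Matrix (a × c) (a × c) ℂ →ₗ[ℂ] Matrix (b × d) (b × d) ℂ where
  toFun X := ∑ i, ∑ j, ∑ k, ∑ l,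
    X (i, k) (j, l) • (Φ (Matrix.single i j 1) ⊗ₖ Ψ (Matrix.single k l 1))
  map_add' X Y := by
    simp only [Matrix.add_apply, add_smul, Finset.sum_add_distrib]
  map_smul' r X := by
    simp only [Matrix.smul_apply, smul_eq_mul, mul_smul, Finset.smul_sum, RingHom.id_apply]

/-- The noiseless classical one-bit channel `X ↦ ∑ i, ⟨i|X|i⟩ |i⟩⟨i|` on `ℂ^2`. -/
def bitChannel : Matrix (Fin 2) (Fin 2) ℂ →ₗ[ℂ] Matrix (Fin 2) (Fin 2) ℂ where
  toFun X := ∑ i, X i i • Matrix.single i i 1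
  map_add' X Y := by
    simp only [Matrix.add_apply, add_smul, Finset.sum_add_distrib]
  map_smul' r X := by
    simp only [Matrix.smul_apply, smul_eq_mul, mul_smul, Finset.smul_sum, RingHom.id_apply]

/-! ### Non-signaling codes

Alice has input system `x` (the message) and output system `a` (the channel input); Bob has input
system `b` (the channel output) and output system `y` (the decoded message). A bipartite linear map
from `x ⊗ b` to `a ⊗ y` is given by its Choi matrix `J` on `x ⊗ a ⊗ b ⊗ y`. -/

/-- The marginal of `J` on Alice's input and both of Bob's systems. -/
def traceAliceOut [Fintype a] (J : Matrix (x × a × b × y) (x × a × b × y) ℂ) :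
    Matrix (x × b × y) (x × b × y) ℂ :=
  Matrix.of fun p q => ∑ s, J (p.1, s, p.2) (q.1, s, q.2)

/-- The marginal of `J` on both of Alice's systems and Bob's input. -/
def traceBobOut [Fintype y] (J : Matrix (x × a × b × y) (x × a × b × y) ℂ) :
    Matrix ((x × a) × b) ((x × a) × b) ℂ :=
  Matrix.of fun p q => ∑ t, J (p.1.1, p.1.2, p.2, t) (q.1.1, q.1.2, q.2, t)

/-- The marginal of `J` on the two input systems. -/
def traceOut [Fintype a] [Fintype y] (J : Matrix (x × a × b × y) (x × a × b × y) ℂ) :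
    Matrix (x × b) (x × b) ℂ :=
  Matrix.of fun p q => ∑ s, ∑ t, J (p.1, s, p.2, t) (q.1, s, q.2, t)

/-- `J` is the Choi matrix of a bipartite quantum channel (positive semidefinite with identity
marginal on the inputs) that is non-signaling from Alice to Bob and from Bob to Alice. -/
structure IsNonSignaling [Fintype x] [Fintype a] [Fintype b] [Fintype y]
    [DecidableEq x] [DecidableEq b]
    (J : Matrix (x × a × b × y) (x × a × b × y) ℂ) : Prop where
  posSemidef : J.PosSemidef
  tracePreserving : traceOut J = 1
  aliceToBob : ∃ K : Matrix (b × y) (b × y) ℂ, traceAliceOut J = (1 : Matrix x x ℂ) ⊗ₖ K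
  bobToAlice : ∃ K : Matrix (x × a) (x × a) ℂ, traceBobOut J = K ⊗ₖ (1 : Matrix b b ℂ)

/-- The effective channel from `x` to `y` obtained by connecting Alice's output through the channel
`W` to Bob's input. -/
def effectiveChannel [Fintype x] [Fintype a] [Fintype b] [DecidableEq a]
    (J : Matrix (x × a × b × y) (x × a × b × y) ℂ)
    (W : Matrix a a ℂ →ₗ[ℂ] Matrix b b ℂ) (X : Matrix x x ℂ) : Matrix y y ℂ :=
  Matrix.of fun t t' => ∑ i, ∑ i', ∑ s, ∑ s', ∑ r, ∑ r',
    X i i' * W (Matrix.single s s' 1) r r' * J (i, s, r, t) (i', s', r', t')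

/-- The average success probability of the non-signaling code `J` for `N` messages. -/
def successProb [Fintype a] [Fintype b] [DecidableEq a] (N : ℕ)
    (J : Matrix (Fin N × a × b × Fin N) (Fin N × a × b × Fin N) ℂ)
    (W : Matrix a a ℂ →ₗ[ℂ] Matrix b b ℂ) : ℝ :=
  (1 / (N : ℝ)) * ∑ m : Fin N, (effectiveChannel J W (Matrix.single m m 1) m m).re

/-- The optimal non-signaling error probability for `N` messages. -/
def epsNS [Fintype a] [Fintype b] [DecidableEq a] [DecidableEq b] (N : ℕ)
    (W : Matrix a a ℂ →ₗ[ℂ] Matrix b b ℂ) : EReal :=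
  1 - ⨆ (J : Matrix (Fin N × a × b × Fin N) (Fin N × a × b × Fin N) ℂ) (_ : IsNonSignaling J),
    (successProb N J W : EReal)

/-! ### The meta-converse -/

/-- The quantum hypothesis testing relative entropy
`-log min {Tr[σ O] | 0 ≤ O ≤ 1, Tr[ρ O] ≥ 1 - ε}`, with `log 0 = -∞`. -/
def hypothesisTestingEntropy [Fintype a] [DecidableEq a] (ε : ℝ) (ρ σ : Matrix a a ℂ) : EReal :=
  -ENNReal.log (⨅ (O : Matrix a a ℂ)
    (_ : O.PosSemidef ∧ (1 - O).PosSemidef ∧ 1 - ε ≤ (ρ * O).trace.re),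
    ENNReal.ofReal (σ * O).trace.re)

/-- The state `√ρ_R J_RB √ρ_R`: the output of the channel on half of the canonical purification
of `ρ`. -/
def channelState [Fintype a] [Fintype b] [DecidableEq a] [DecidableEq b]
    (W : Matrix a a ℂ →ₗ[ℂ] Matrix b b ℂ) (ρ : Matrix a a ℂ) : Matrix (a × b) (a × b) ℂ :=
  (CFC.sqrt ρ ⊗ₖ (1 : Matrix b b ℂ)) * choi W * (CFC.sqrt ρ ⊗ₖ (1 : Matrix b b ℂ))

/-- The meta-converse error probability: the least `ε ∈ [0, 1]` such that
`sup_ρ inf_σ D_H^ε(√ρ_R J_RB √ρ_R ‖ ρ_R ⊗ σ_B) ≥ log M`. -/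
def epsMC [Fintype a] [Fintype b] [DecidableEq a] [DecidableEq b] (M : ℕ)
    (W : Matrix a a ℂ →ₗ[ℂ] Matrix b b ℂ) : EReal :=
  ⨅ (ε : ℝ) (_ : 0 ≤ ε ∧ ε ≤ 1 ∧ ((Real.log M : ℝ) : EReal) ≤
      ⨆ (ρ : Matrix a a ℂ) (_ : IsState ρ), ⨅ (σ : Matrix b b ℂ) (_ : IsState σ),
        hypothesisTestingEntropy ε (channelState W ρ) (ρ ⊗ₖ σ)),
    (ε : EReal)

/-! ### The non-commutative minimum -/

/-- The non-commutative minimum `A ∧ B = (A + B - |A - B|) / 2`. -/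
def opMin [Fintype a] [DecidableEq a] (A B : Matrix a a ℂ) : Matrix a a ℂ :=
  (1 / 2 : ℂ) • (A + B - CFC.abs (A - B))

end NSCoding

end

open NSCoding

open scoped MatrixOrder ComplexOrder Kronecker

noncomputable section

namespace NSCoding

variable {a b : Type*}

open Matrix Set Filter Topology

/-! ### A minimax principle -/

/-! All three quantities equal `1 - v`, where `v` is the value of the semidefinite program: maximize
Tr[J_W L] subject to 0 ≤ L ≤ ρ ⊗ 1 and M · Tr_R L ≤ 1, over states ρ (`metaConverseValues`).

Meta-converse: the substitution L = √ρ O √ρ identifies tests O with feasible L, up to an arbitrarily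
small loss when ρ is singular. The bound M · Tr_R L ≤ 1 says that the type-II error of O is at most
1/M against every ρ ⊗ σ. The definition lets the test depend on σ, and the minimax principle
supplies one test for all σ (`epsMC_eq`). The trace of X ∧ Y is a minimum over tests of Tr[X(1 - O)]
+ Tr[Y O]. After the same exchange, the supremum over the cone of Z acts as a Lagrange multiplier
enforcing the type-II bound (`iInf_iSup_opMin_eq`).

Non-signaling codes: averaging the correctly decoded blocks of a code with N messages gives 0 ≤ L ≤
ρ ⊗ 1, but with the equality N · Tr_R L = 1. Conversely, for N ≥ 2 each such L comes from a code.
The only gap to the program is equality against inequality. The bit closes it: the success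
probability of W ⊗ I_2 sees only blocks with equal input and output bits, so the other blocks can
absorb the slack. Each output bit value sees total weight 1/(2M), and the two values together give
the bound 1/M (`epsNS_eq`). -/

/-- A one-sided minimax principle for convex-concave functions on a compact convex set. -/
theorem exists_forall_le_of_forall_exists_le {E F : Type*} [AddCommGroup E] [Module ℝ E]
    [TopologicalSpace E] [AddCommGroup F] [Module ℝ F] {K : Set E} {C : Set F}
    (hK : IsCompact K) (hC : C.Nonempty) (f : E → F → ℝ)
    (hcont : ∀ z ∈ C, Continuous fun x => f x z)
    (hconvex : ∀ z ∈ C, ConvexOn ℝ K fun x => f x z)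
    (hconcave : ∀ x ∈ K, ConcaveOn ℝ C (f x)) {v w : ℝ} (hvw : v < w)
    (h : ∀ z ∈ C, ∃ x ∈ K, f x z ≤ v) : ∃ x ∈ K, ∀ z ∈ C, f x z ≤ w := by
  classical
  by_contra! hcon
  obtain ⟨z₀, hz₀⟩ := hC
  obtain ⟨x₀, hx₀, -⟩ := h z₀ hz₀
  have hKconv : Convex ℝ K := (hconvex z₀ hz₀).1
  have hCconv : Convex ℝ C := (hconcave x₀ hx₀).1
  obtain ⟨t, ht⟩ := hK.elim_finite_subcover (fun z : C => {x | w < f x z})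
    (fun z => isOpen_lt continuous_const (hcont z z.2))
    (fun x hx => by
      obtain ⟨z, hz, hlt⟩ := hcon x hx
      exact mem_iUnion.2 ⟨⟨z, hz⟩, hlt⟩)
  -- By compactness finitely many `z` already refute every `x`. Then the upward closure `S` of the
  -- attainable value vectors misses the open orthant `T`, and Hahn–Banach separates them.
  let S : Set (t → ℝ) := {u | ∃ x ∈ K, ∀ i : t, f x i.1 ≤ u i}
  let T : Set (t → ℝ) := {u | ∀ i, u i < w}
  have hS : Convex ℝ S := by
    rintro u ⟨x, hx, hu⟩ u' ⟨x', hx', hu'⟩ r r' hr hr' hrr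
    refine ⟨r • x + r' • x', hKconv hx hx' hr hr' hrr, fun i => ?_⟩
    refine ((hconvex i.1 i.1.2).2 hx hx' hr hr' hrr).trans ?_
    simp only [smul_eq_mul, Pi.add_apply, Pi.smul_apply]
    exact add_le_add (mul_le_mul_of_nonneg_left (hu i) hr)
      (mul_le_mul_of_nonneg_left (hu' i) hr')
  have hT : Convex ℝ T := by
    have : T = Set.pi univ fun _ => Iio w := by ext; simp [T]
    rw [this]
    exact convex_pi fun i _ => convex_Iio w
  have hTo : IsOpen T := by
    have : T = Set.pi univ fun _ => Iio w := by ext; simp [T]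
    rw [this]
    exact isOpen_set_pi finite_univ fun i _ => isOpen_Iio
  have hdisj : Disjoint T S := by
    rw [Set.disjoint_left]
    rintro u hu ⟨x, hx, hux⟩
    obtain ⟨z, hz, hlt⟩ : ∃ z, ∃ _ : z ∈ t, w < f x z := by
      simpa using ht hx
    exact absurd (hlt.trans_le (hux ⟨z, hz⟩)) (hu ⟨z, hz⟩).not_gt
  obtain ⟨φ, s, hφT, hφS⟩ := geometric_hahn_banach_open hT hTo hS hdisj
  set c : t → ℝ := fun i => φ (Pi.single i 1) with hc
  have hφ : ∀ u, φ u = ∑ i, u i * c i := by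
    intro u
    conv_lhs => rw [← Finset.univ_sum_single u]
    rw [map_sum]
    refine Finset.sum_congr rfl fun i _ => ?_
    rw [hc, ← smul_eq_mul, ← map_smul, ← Pi.single_smul]
    simp
  have hSne : (fun i : t => f x₀ i.1) ∈ S := ⟨x₀, hx₀, fun i => le_rfl⟩
  -- `S` is closed upwards, so a negative coefficient would make `φ` unbounded below on it.
  have hcnonneg : ∀ i, 0 ≤ c i := by
    intro i
    by_contra! hneg
    have key : ∀ r : ℝ, 0 ≤ r → s ≤ φ (fun i : t => f x₀ i.1) + r * c i := by
      intro r hr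
      have hmem : (fun j : t => f x₀ j.1) + r • Pi.single i 1 ∈ S := by
        refine ⟨x₀, hx₀, fun j => ?_⟩
        have : 0 ≤ (r • (Pi.single i 1 : t → ℝ)) j := by
          by_cases hij : j = i
          · subst hij; simpa using hr
          · simp [hij]
        simpa using this
      simpa [hc] using hφS _ hmem
    have h1 := key ((s - φ (fun i : t => f x₀ i.1) - 1) / c i)
    have h2 := hφS _ hSne
    have h3 := h1 (div_nonneg_of_nonpos (by linarith) hneg.le)
    rw [div_mul_cancel₀ _ hneg.ne] at h3
    linarith
  have hle : w * ∑ i, c i ≤ s := by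
    refine le_of_forall_pos_le_add fun δ hδ => ?_
    have hpos : 0 < 1 + ∑ i, c i := by
      have := Finset.sum_nonneg fun i (_ : i ∈ Finset.univ) => hcnonneg i
      linarith
    have hmem : (fun _ : t => w - δ / (1 + ∑ i, c i)) ∈ T := fun i => by
      have := div_pos hδ hpos
      linarith
    have h1 := (hφT _ hmem).le
    rw [hφ, ← Finset.mul_sum, sub_mul] at h1
    have h2 : δ / (1 + ∑ i, c i) * ∑ i, c i ≤ δ := by
      rw [div_mul_eq_mul_div, div_le_iff₀ hpos]
      nlinarith
    linarith
  have hsum : 0 < ∑ i, c i := by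
    refine lt_of_le_of_ne (Finset.sum_nonneg fun i _ => hcnonneg i) fun h0 => ?_
    have hzero : ∀ i, c i = 0 := by
      intro i
      exact (Finset.sum_eq_zero_iff_of_nonneg fun i _ => hcnonneg i).1 h0.symm i (Finset.mem_univ i)
    have h1 := hφT (fun _ => w - 1) fun i => by linarith
    have h2 := hφS _ hSne
    simp only [hφ, hzero, mul_zero, Finset.sum_const_zero] at h1 h2
    linarith
  -- The normalized separating functional is a mixture of the chosen `z`; by concavity its value at
  -- every `x` in `K` is at least `w > v`.
  set d : t → ℝ := fun i => (∑ i, c i)⁻¹ * c i with hd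
  have hdnonneg : ∀ i ∈ Finset.univ, 0 ≤ d i := fun i _ =>
    mul_nonneg (inv_nonneg.2 hsum.le) (hcnonneg i)
  have hdsum : ∑ i, d i = 1 := by
    rw [hd, ← Finset.mul_sum, inv_mul_cancel₀ hsum.ne']
  obtain ⟨x, hx, hxv⟩ := h (∑ i, d i • (i.1 : F))
    (hCconv.sum_mem hdnonneg hdsum fun i _ => i.1.2)
  have h1 := (hconcave x hx).le_map_sum hdnonneg hdsum fun i _ => i.1.2
  have h2 := hφS (fun i : t => f x i.1) ⟨x, hx, fun i => le_rfl⟩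
  rw [hφ] at h2
  have h3 : ∑ i, d i • f x i.1 = (∑ i, c i)⁻¹ * ∑ i, f x i.1 * c i := by
    rw [Finset.mul_sum]
    refine Finset.sum_congr rfl fun i _ => ?_
    simp only [hd, smul_eq_mul]
    ring
  have h4 : w ≤ (∑ i, c i)⁻¹ * ∑ i, f x i.1 * c i := by
    rw [inv_mul_eq_div, le_div_iff₀ hsum]
    linarith
  linarith

/-! ### Positive semidefinite matrices -/

section PosSemidef

variable {n m ι κ : Type*} [Fintype n] [Fintype m]

theorem trace_mul_re_nonneg [DecidableEq n] {A B : Matrix n n ℂ} (hA : A.PosSemidef)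
    (hB : B.PosSemidef) : 0 ≤ (A * B).trace.re := by
  have h : (A * B).trace = (CFC.sqrt A * B * (CFC.sqrt A)ᴴ).trace := by
    have h1 : (CFC.sqrt A)ᴴ = CFC.sqrt A :=
      (Matrix.nonneg_iff_posSemidef.1 (CFC.sqrt_nonneg A)).isHermitian
    rw [h1, Matrix.trace_mul_comm (CFC.sqrt A * B), ← Matrix.mul_assoc,
      CFC.sqrt_mul_sqrt_self A (Matrix.nonneg_iff_posSemidef.2 hA)]
  rw [h]
  exact (Complex.le_def.1 (hB.mul_mul_conjTranspose_same _).trace_nonneg).1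

theorem trace_re_nonneg {A : Matrix n n ℂ} (hA : A.PosSemidef) : 0 ≤ A.trace.re :=
  (Complex.le_def.1 hA.trace_nonneg).1

theorem isClosed_posSemidef : IsClosed {A : Matrix n n ℂ | A.PosSemidef} := by
  have : {A : Matrix n n ℂ | A.PosSemidef} =
      {A | Aᴴ = A} ∩ ⋂ x : n → ℂ, {A | 0 ≤ star x ⬝ᵥ A *ᵥ x} := by
    ext A
    simp only [mem_ofPred_eq, Set.mem_inter_iff, mem_iInter, Matrix.posSemidef_iff_dotProduct_mulVec]
    rfl
  rw [this]
  refine (isClosed_eq (by fun_prop) continuous_id).inter (isClosed_iInter fun x => ?_)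
  have hc : Continuous fun A : Matrix n n ℂ => star x ⬝ᵥ A *ᵥ x := by fun_prop
  exact isClosed_Ici.preimage hc

theorem convex_posSemidef {k : Type*} : Convex ℝ {A : Matrix k k ℂ | A.PosSemidef} := by
  intro A hA B hB r s hr hs _
  have h1 := hA.smul (a := (r : ℂ)) (by exact_mod_cast hr)
  have h2 := hB.smul (a := (s : ℂ)) (by exact_mod_cast hs)
  simpa using h1.add h2

/-- The set of effects `0 ≤ O ≤ 1`. -/
def effects (n : Type*) [Fintype n] [DecidableEq n] : Set (Matrix n n ℂ) :=
  {O | O.PosSemidef ∧ (1 - O).PosSemidef}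

theorem convex_effects [DecidableEq n] : Convex ℝ (effects n) := by
  intro A hA B hB r s hr hs hrs
  refine ⟨convex_posSemidef hA.1 hB.1 hr hs hrs, ?_⟩
  have : (1 : Matrix n n ℂ) - (r • A + s • B) = r • (1 - A) + s • (1 - B) := by
    have h1 : (1 : Matrix n n ℂ) = (r + s) • (1 : Matrix n n ℂ) := by rw [hrs, one_smul]
    rw [smul_sub, smul_sub]
    conv_lhs => rw [h1, add_smul]
    abel
  rw [this]
  exact convex_posSemidef hA.2 hB.2 hr hs hrs

/-- Conjugating 1 - O by √O gives O² ≤ O, so the squared norm of row i is at most O_ii ≤ 1. -/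
theorem norm_apply_le_one_of_mem_effects [DecidableEq n] {O : Matrix n n ℂ} (hO : O ∈ effects n)
    (i j : n) : ‖O i j‖ ≤ 1 := by
  obtain ⟨h0, h1⟩ := hO
  have hs : CFC.sqrt O * CFC.sqrt O = O :=
    CFC.sqrt_mul_sqrt_self O (Matrix.nonneg_iff_posSemidef.2 h0)
  have hsh : (CFC.sqrt O)ᴴ = CFC.sqrt O :=
    (Matrix.nonneg_iff_posSemidef.1 (CFC.sqrt_nonneg O)).isHermitian
  have h2 : (O - O * Oᴴ).PosSemidef := by
    have := h1.mul_mul_conjTranspose_same (CFC.sqrt O)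
    rw [hsh, Matrix.mul_sub, Matrix.sub_mul, Matrix.mul_one, hs] at this
    rw [h0.isHermitian.eq]
    convert this using 2
    have hcomm : ∀ S : Matrix n n ℂ, S * S = O → S * O = O * S := fun S h => by
      rw [← h, Matrix.mul_assoc]
    rw [hcomm _ hs, Matrix.mul_assoc, hs]
  have hd1 := (Complex.le_def.1 (h1.diag_nonneg (i := i))).1
  have hd2 := (Complex.le_def.1 (h2.diag_nonneg (i := i))).1
  have hsum : ((O * Oᴴ) i i).re = ∑ k, ‖O i k‖ ^ 2 := by
    rw [Matrix.mul_apply, Complex.re_sum]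
    refine Finset.sum_congr rfl fun k _ => ?_
    rw [Matrix.conjTranspose_apply, Complex.star_def, Complex.mul_conj, Complex.ofReal_re,
      Complex.normSq_eq_norm_sq]
  simp only [Matrix.sub_apply, Matrix.one_apply_eq, Complex.sub_re, Complex.zero_re,
    Complex.one_re, hsum] at hd1 hd2
  have hle := Finset.single_le_sum (f := fun k => ‖O i k‖ ^ 2) (fun k _ => by positivity)
    (Finset.mem_univ j)
  nlinarith [norm_nonneg (O i j)]

theorem isCompact_effects [DecidableEq n] : IsCompact (effects n) := by
  have hc : IsCompact (X := n → n → ℂ) (Set.pi univ fun _ : n => Set.pi univ fun _ : n =>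
      Metric.closedBall (0 : ℂ) 1) :=
    isCompact_univ_pi fun _ => isCompact_univ_pi fun _ => isCompact_closedBall _ _
  refine IsCompact.of_isClosed_subset (X := Matrix n n ℂ) hc ?_ ?_
  · exact isClosed_posSemidef.inter
      (isClosed_posSemidef.preimage (f := fun O : Matrix n n ℂ => 1 - O) (by fun_prop))
  · intro O hO i _ j _
    simpa using norm_apply_le_one_of_mem_effects hO i j

theorem zero_mem_effects [DecidableEq n] : (0 : Matrix n n ℂ) ∈ effects n :=
  ⟨.zero, by simpa using Matrix.PosSemidef.one⟩

/-- A matrix that is block diagonal with respect to the labelling `g` is positive semidefinite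
as soon as its blocks are compressions of positive semidefinite matrices. -/
theorem posSemidef_ite_eq [Fintype ι] [DecidableEq ι] [DecidableEq n] (g : n → ι) (f : n → κ)
    {A : ι → Matrix κ κ ℂ} (hA : ∀ i, (A i).PosSemidef) :
    (Matrix.of fun p q => if g p = g q then A (g p) (f p) (f q) else 0 :
      Matrix n n ℂ).PosSemidef := by
  -- The matrix is a sum, over labels, of compressions by the coordinate projection onto that label.
  have h : (Matrix.of fun p q => if g p = g q then A (g p) (f p) (f q) else 0 : Matrix n n ℂ) =
      ∑ i, (Matrix.diagonal fun p => if g p = i then (1 : ℂ) else 0) * (A i).submatrix f f *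
        (Matrix.diagonal fun p => if g p = i then (1 : ℂ) else 0)ᴴ := by
    ext p q
    rw [Matrix.sum_apply]
    simp only [Matrix.diagonal_conjTranspose, Matrix.mul_diagonal, Matrix.diagonal_mul,
      Matrix.submatrix_apply, Matrix.of_apply, ite_mul, one_mul, zero_mul, Pi.star_apply]
    rw [Finset.sum_eq_single (g p)]
    · by_cases hpq : g p = g q
      · simp [hpq]
      · simp [hpq, Ne.symm hpq]
    · intro i _ hi
      simp [Ne.symm hi]
    · simp
  rw [h]
  exact Matrix.posSemidef_sum _ fun i _ => ((hA i).submatrix f).mul_mul_conjTranspose_same _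

end PosSemidef

/-! ### The non-commutative minimum as an optimization over effects -/

section OpMin

variable {n : Type*} [Fintype n] [DecidableEq n]

theorem opMin_eq_sub_posPart {X Y : Matrix n n ℂ} (h : (X - Y).IsHermitian) :
    opMin X Y = X - (X - Y)⁺ := by
  have hsa : IsSelfAdjoint (X - Y) := h
  have h1 := CFC.posPart_add_negPart (X - Y) hsa
  have h2 := CFC.posPart_sub_negPart (X - Y) hsa
  have h3 : X + Y = (2 : ℂ) • X - (X - Y) := by
    rw [two_smul]; abel
  have h4 : X + Y - CFC.abs (X - Y) = (2 : ℂ) • (X - (X - Y)⁺) := by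
    rw [h3, ← h1]
    nth_rw 1 [← h2]
    rw [smul_sub, two_smul ℂ ((X - Y)⁺)]
    abel
  rw [opMin, h4, smul_smul]
  norm_num

/-- Half of the Helstrom bound: for D = X - Y, Tr[D O] ≤ Tr[D⁺ O] ≤ Tr[D⁺]. -/
theorem trace_opMin_le {X Y O : Matrix n n ℂ} (h : (X - Y).IsHermitian) (hO : O ∈ effects n) :
    (opMin X Y).trace.re ≤ X.trace.re - (X * O).trace.re + (Y * O).trace.re := by
  have hsa : IsSelfAdjoint (X - Y) := h
  have h2 := CFC.posPart_sub_negPart (X - Y) hsa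
  have hP := trace_mul_re_nonneg
    (Matrix.nonneg_iff_posSemidef.1 (CFC.posPart_nonneg (X - Y))) hO.2
  have hN := trace_mul_re_nonneg
    (Matrix.nonneg_iff_posSemidef.1 (CFC.negPart_nonneg (X - Y))) hO.1
  have h3 : ((X - Y) * O).trace.re = ((X - Y)⁺ * O).trace.re - ((X - Y)⁻ * O).trace.re := by
    conv_lhs => rw [← h2]
    rw [Matrix.sub_mul, Matrix.trace_sub, Complex.sub_re]
  rw [Matrix.sub_mul, Matrix.trace_sub, Complex.sub_re] at h3
  rw [Matrix.mul_sub, Matrix.mul_one, Matrix.trace_sub, Complex.sub_re] at hP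
  rw [opMin_eq_sub_posPart h, Matrix.trace_sub, Complex.sub_re]
  linarith

theorem exists_trace_opMin_eq {X Y : Matrix n n ℂ} (h : (X - Y).IsHermitian) :
    ∃ O ∈ effects n,
      (opMin X Y).trace.re = X.trace.re - (X * O).trace.re + (Y * O).trace.re := by
  have hsa : IsSelfAdjoint (X - Y) := h
  -- The spectrum is finite, so the functional calculus accepts the discontinuous indicator that
  -- defines the optimal test, the projection onto the positive part.
  have hcont : ∀ f : ℝ → ℝ, ContinuousOn f (spectrum ℝ (X - Y)) := fun f =>
    (Matrix.finite_real_spectrum (A := X - Y)).continuousOn f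
  set O : Matrix n n ℂ := cfc (fun r : ℝ => if 0 < r then 1 else 0) (X - Y) with hO
  refine ⟨O, ⟨?_, ?_⟩, ?_⟩
  · rw [← Matrix.nonneg_iff_posSemidef]
    exact cfc_nonneg fun r _ => by split_ifs <;> norm_num
  · have : 1 - O = cfc (fun r : ℝ => 1 - if 0 < r then 1 else 0) (X - Y) := by
      rw [cfc_sub _ _ _ (hcont _) (hcont _), cfc_const_one ℝ (X - Y)]
    rw [this, ← Matrix.nonneg_iff_posSemidef]
    exact cfc_nonneg fun r _ => by split_ifs <;> norm_num
  · have hmul : (X - Y) * O = (X - Y)⁺ := by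
      rw [CFC.posPart_def, cfcₙ_eq_cfc]
      nth_rw 1 [← cfc_id ℝ (X - Y) hsa]
      rw [hO, ← cfc_mul _ _ _ (hcont _) (hcont _)]
      refine cfc_congr fun r _ => ?_
      by_cases hr : 0 < r
      · simp [hr, hr.le]
      · simp [hr, not_lt.1 hr]
    rw [opMin_eq_sub_posPart h, ← hmul, Matrix.sub_mul]
    simp only [Matrix.trace_sub, Complex.sub_re]
    ring

end OpMin

/-! ### The primal form of the meta-converse -/

section Primal

variable [Fintype a] [Fintype b]

/-- The partial trace over the first tensor factor. -/
def ptr (L : Matrix (a × b) (a × b) ℂ) : Matrix b b ℂ :=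
  Matrix.of fun r r' => ∑ s, L (s, r) (s, r')

omit [Fintype b] in
theorem ptr_posSemidef {L : Matrix (a × b) (a × b) ℂ} (hL : L.PosSemidef) :
    (ptr L).PosSemidef := by
  have : ptr L = ∑ s, L.submatrix (fun r => (s, r)) fun r => (s, r) := by
    ext r r'
    simp [ptr, Matrix.sum_apply]
  rw [this]
  exact Matrix.posSemidef_sum _ fun s _ => hL.submatrix _

theorem trace_one_kronecker_mul [DecidableEq a] (σ : Matrix b b ℂ)
    (L : Matrix (a × b) (a × b) ℂ) :
    (((1 : Matrix a a ℂ) ⊗ₖ σ) * L).trace = (σ * ptr L).trace := by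
  simp only [Matrix.trace, Matrix.diag_apply, Matrix.mul_apply, Fintype.sum_prod_type,
    Matrix.kroneckerMap_apply, Matrix.one_apply, ite_mul, one_mul, zero_mul, ptr, Matrix.of_apply,
    Finset.mul_sum, Finset.sum_ite_irrel, Finset.sum_const_zero, Finset.sum_ite_eq,
    Finset.mem_univ, if_true]
  rw [Finset.sum_comm]
  exact Finset.sum_congr rfl fun r _ => Finset.sum_comm

-- Self-duality of the positive cone; rank-one σ suffice for the converse.
omit [Fintype b] in
theorem posSemidef_iff_trace_mul_nonneg {n : Type*} [Fintype n] [DecidableEq n]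
    {A : Matrix n n ℂ} (hA : A.IsHermitian) :
    A.PosSemidef ↔ ∀ σ : Matrix n n ℂ, σ.PosSemidef → 0 ≤ (σ * A).trace.re := by
  refine ⟨fun h σ hσ => trace_mul_re_nonneg hσ h, fun h => ?_⟩
  refine Matrix.PosSemidef.of_dotProduct_mulVec_nonneg hA fun x => ?_
  have h1 := h _ (Matrix.posSemidef_vecMulVec_self_star x)
  rw [Matrix.vecMulVec_mul, Matrix.trace_vecMulVec, dotProduct_comm,
    ← Matrix.dotProduct_mulVec] at h1
  have h2 := hA.im_star_dotProduct_mulVec_self x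
  exact Complex.le_def.2 ⟨by simpa using h1, by simpa using h2.symm⟩

theorem one_sub_smul_ptr_posSemidef_iff [DecidableEq a] [DecidableEq b]
    {L : Matrix (a × b) (a × b) ℂ} (hL : L.PosSemidef) (M : ℕ) :
    (1 - (M : ℂ) • ptr L).PosSemidef ↔ ∀ σ : Matrix b b ℂ, σ.PosSemidef →
      M * (((1 : Matrix a a ℂ) ⊗ₖ σ) * L).trace.re ≤ σ.trace.re := by
  have hH : (1 - (M : ℂ) • ptr L).IsHermitian := by
    refine Matrix.isHermitian_one.sub ?_
    exact ((ptr_posSemidef hL).smul (a := (M : ℂ)) (by positivity)).isHermitian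
  rw [posSemidef_iff_trace_mul_nonneg hH]
  refine forall₂_congr fun σ _ => ?_
  rw [trace_one_kronecker_mul, Matrix.mul_sub, Matrix.mul_one, Matrix.mul_smul, Matrix.trace_sub,
    Matrix.trace_smul, Complex.sub_re, smul_eq_mul, ← Complex.ofReal_natCast,
    Complex.re_ofReal_mul, sub_nonneg]

/-- The values of the semidefinite program of the meta-converse. -/
def metaConverseValues [DecidableEq a] [DecidableEq b] (M : ℕ)
    (W : Matrix a a ℂ →ₗ[ℂ] Matrix b b ℂ) : Set ℝ :=
  {v | ∃ (ρ : Matrix a a ℂ) (L : Matrix (a × b) (a × b) ℂ), IsState ρ ∧ L.PosSemidef ∧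
    (ρ ⊗ₖ (1 : Matrix b b ℂ) - L).PosSemidef ∧ (1 - (M : ℂ) • ptr L).PosSemidef ∧
    v = (choi W * L).trace.re}

omit [Fintype b] in
theorem choi_apply [DecidableEq a] (W : Matrix a a ℂ →ₗ[ℂ] Matrix b b ℂ) (s s' : a) (r r' : b) :
    choi W (s, r) (s', r') = W (Matrix.single s s' 1) r r' := by
  simp only [choi, Matrix.sum_apply, Matrix.kroneckerMap_apply]
  rw [Finset.sum_eq_single s, Finset.sum_eq_single s'] <;>
    simp +contextual [Matrix.single_apply]

theorem choi_posSemidef [DecidableEq a] {W : Matrix a a ℂ →ₗ[ℂ] Matrix b b ℂ}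
    (hW : IsQuantumChannel W) : (choi W).PosSemidef := by
  set e := Fintype.equivFin a
  -- The unnormalized maximally entangled vector: its projector is sent by the ampliation to the
  -- Choi matrix.
  let u : Fin (Fintype.card a) × a → ℂ := fun p => if e.symm p.1 = p.2 then 1 else 0
  have h := (hW.completelyPositive (Fintype.card a) _
    (Matrix.posSemidef_vecMulVec_self_star u)).submatrix
      (fun p : a × b => (e p.1, p.2))
  convert h using 1
  ext ⟨s, r⟩ ⟨s', r'⟩
  rw [choi_apply, Matrix.submatrix_apply, ampliation, Matrix.of_apply]
  have hs : Matrix.single s s' (1 : ℂ) =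
      Matrix.of fun i j => Matrix.vecMulVec u (star u) (e s, i) (e s', j) := by
    ext i j
    simp [u, Matrix.vecMulVec_apply, Matrix.single_apply, ← ite_and, and_comm]
  rw [hs]

theorem trace_kronecker_one_mul_choi [DecidableEq a] [DecidableEq b]
    {W : Matrix a a ℂ →ₗ[ℂ] Matrix b b ℂ} (hW : IsQuantumChannel W) (ρ : Matrix a a ℂ) :
    ((ρ ⊗ₖ (1 : Matrix b b ℂ)) * choi W).trace = ρ.trace := by
  have h : ∀ s s' : a, ∑ r, W (Matrix.single s s' 1) r r = if s = s' then 1 else 0 := by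
    intro s s'
    have := hW.tracePreserving (Matrix.single s s' 1)
    rw [Matrix.trace] at this
    simp only [Matrix.diag_apply] at this
    rw [this]
    by_cases hs : s = s'
    · subst hs; simp
    · simp [hs]
  simp only [Matrix.trace, Matrix.diag_apply, Matrix.mul_apply, Fintype.sum_prod_type,
    Matrix.kroneckerMap_apply, Matrix.one_apply, mul_ite, ite_mul, mul_one, mul_zero, zero_mul,
    Finset.sum_ite_eq, Finset.mem_univ, if_true, choi_apply]
  refine Finset.sum_congr rfl fun s _ => ?_
  rw [Finset.sum_comm]
  simp [← Finset.mul_sum, h]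

/-! ### Conjugation by √ρ: tests and feasible points -/

section Sqrt

variable [DecidableEq a] [DecidableEq b]

omit [Fintype b] in
theorem sqrt_kronecker_conjTranspose (ρ : Matrix a a ℂ) :
    (CFC.sqrt ρ ⊗ₖ (1 : Matrix b b ℂ))ᴴ = CFC.sqrt ρ ⊗ₖ (1 : Matrix b b ℂ) := by
  have h : (CFC.sqrt ρ)ᴴ = CFC.sqrt ρ :=
    (Matrix.nonneg_iff_posSemidef.1 (CFC.sqrt_nonneg ρ)).isHermitian
  rw [Matrix.conjTranspose_kronecker, h, Matrix.conjTranspose_one]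

theorem sqrt_kronecker_mul_mul {ρ : Matrix a a ℂ} (hρ : ρ.PosSemidef) (σ : Matrix b b ℂ) :
    (CFC.sqrt ρ ⊗ₖ (1 : Matrix b b ℂ)) * ((1 : Matrix a a ℂ) ⊗ₖ σ) *
      (CFC.sqrt ρ ⊗ₖ (1 : Matrix b b ℂ)) = ρ ⊗ₖ σ := by
  rw [← Matrix.mul_kronecker_mul, ← Matrix.mul_kronecker_mul, Matrix.mul_one, Matrix.one_mul,
    Matrix.mul_one, CFC.sqrt_mul_sqrt_self ρ (Matrix.nonneg_iff_posSemidef.2 hρ)]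

theorem trace_conj_mul {n : Type*} [Fintype n] (S X O : Matrix n n ℂ) :
    (S * X * S * O).trace = (X * (S * O * S)).trace := by
  rw [Matrix.mul_assoc, Matrix.mul_assoc, Matrix.trace_mul_comm]
  simp only [Matrix.mul_assoc]

theorem trace_channelState_mul (W : Matrix a a ℂ →ₗ[ℂ] Matrix b b ℂ) (ρ : Matrix a a ℂ)
    (O : Matrix (a × b) (a × b) ℂ) :
    (channelState W ρ * O).trace = (choi W * ((CFC.sqrt ρ ⊗ₖ (1 : Matrix b b ℂ)) * O *
      (CFC.sqrt ρ ⊗ₖ (1 : Matrix b b ℂ)))).trace :=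
  trace_conj_mul _ _ _

theorem trace_kronecker_mul {ρ : Matrix a a ℂ} (hρ : ρ.PosSemidef) (σ : Matrix b b ℂ)
    (O : Matrix (a × b) (a × b) ℂ) :
    ((ρ ⊗ₖ σ) * O).trace = (((1 : Matrix a a ℂ) ⊗ₖ σ) * ((CFC.sqrt ρ ⊗ₖ (1 : Matrix b b ℂ)) * O *
      (CFC.sqrt ρ ⊗ₖ (1 : Matrix b b ℂ)))).trace := by
  rw [← sqrt_kronecker_mul_mul hρ σ, trace_conj_mul]

variable {W : Matrix a a ℂ →ₗ[ℂ] Matrix b b ℂ}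

theorem channelState_posSemidef (hW : IsQuantumChannel W) (ρ : Matrix a a ℂ) :
    (channelState W ρ).PosSemidef := by
  have := (choi_posSemidef hW).mul_mul_conjTranspose_same (CFC.sqrt ρ ⊗ₖ (1 : Matrix b b ℂ))
  rwa [sqrt_kronecker_conjTranspose] at this

theorem trace_channelState (hW : IsQuantumChannel W) {ρ : Matrix a a ℂ} (hρ : IsState ρ) :
    (channelState W ρ).trace = 1 := by
  have h := trace_channelState_mul W ρ 1
  have h1 := sqrt_kronecker_mul_mul hρ.1 (1 : Matrix b b ℂ)
  rw [Matrix.mul_one, Matrix.mul_one, Matrix.trace_mul_comm] at h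
  rw [Matrix.one_kronecker_one, Matrix.mul_one] at h1
  rw [h, h1, trace_kronecker_one_mul_choi hW, hρ.2]

theorem isState_maximallyMixed [Nonempty a] :
    IsState (((Fintype.card a : ℂ)⁻¹) • (1 : Matrix a a ℂ)) := by
  refine ⟨Matrix.PosSemidef.one.smul (by positivity), ?_⟩
  rw [Matrix.trace_smul, Matrix.trace_one, smul_eq_mul, inv_mul_cancel₀]
  exact_mod_cast Fintype.card_ne_zero

theorem zero_mem_metaConverseValues [Nonempty a] (M : ℕ) : (0 : ℝ) ∈ metaConverseValues M W := by
  refine ⟨_, 0, isState_maximallyMixed, .zero, ?_, ?_, by simp⟩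
  · rw [sub_zero]
    exact isState_maximallyMixed.1.kronecker Matrix.PosSemidef.one
  · have : ptr (0 : Matrix (a × b) (a × b) ℂ) = 0 := by ext; simp [ptr]
    rw [this, smul_zero, sub_zero]
    exact Matrix.PosSemidef.one

theorem nonneg_of_mem_metaConverseValues (hW : IsQuantumChannel W) {M : ℕ} {v : ℝ}
    (hv : v ∈ metaConverseValues M W) : 0 ≤ v := by
  obtain ⟨ρ, L, hρ, hL, -, -, rfl⟩ := hv
  exact trace_mul_re_nonneg (choi_posSemidef hW) hL

theorem le_one_of_mem_metaConverseValues (hW : IsQuantumChannel W) {M : ℕ} {v : ℝ}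
    (hv : v ∈ metaConverseValues M W) : v ≤ 1 := by
  obtain ⟨ρ, L, hρ, hL, hρL, -, rfl⟩ := hv
  have h := trace_mul_re_nonneg (choi_posSemidef hW) hρL
  rw [Matrix.mul_sub, Matrix.trace_sub, Matrix.trace_mul_comm _ (ρ ⊗ₖ 1),
    trace_kronecker_one_mul_choi hW, hρ.2] at h
  simpa using h

theorem bddAbove_metaConverseValues (hW : IsQuantumChannel W) (M : ℕ) :
    BddAbove (metaConverseValues M W) :=
  ⟨1, fun _ => le_one_of_mem_metaConverseValues hW⟩

/-- A test `O` whose type-II error is at most `1 / M` gives a feasible point of the program. -/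
theorem mem_metaConverseValues_of_effect {M : ℕ} {ρ : Matrix a a ℂ} (hρ : IsState ρ)
    {O : Matrix (a × b) (a × b) ℂ} (hO : O ∈ effects (a × b))
    (h : ∀ σ : Matrix b b ℂ, σ.PosSemidef → M * ((ρ ⊗ₖ σ) * O).trace.re ≤ σ.trace.re) :
    (channelState W ρ * O).trace.re ∈ metaConverseValues M W := by
  set S := CFC.sqrt ρ ⊗ₖ (1 : Matrix b b ℂ) with hS
  have hSH : Sᴴ = S := sqrt_kronecker_conjTranspose ρ
  have hL : (S * O * S).PosSemidef := by
    have := hO.1.mul_mul_conjTranspose_same S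
    rwa [hSH] at this
  refine ⟨ρ, S * O * S, hρ, hL, ?_, ?_, by rw [trace_channelState_mul]⟩
  · have := hO.2.mul_mul_conjTranspose_same S
    rw [hSH, Matrix.mul_sub, Matrix.sub_mul, ← Matrix.one_kronecker_one,
      sqrt_kronecker_mul_mul hρ.1] at this
    exact this
  · rw [one_sub_smul_ptr_posSemidef_iff hL]
    intro σ hσ
    rw [← trace_kronecker_mul hρ.1]
    exact h σ hσ

/-- Up to an arbitrarily small loss, every feasible point of the program comes from a test. -/
theorem exists_effect_of_mem_metaConverseValues [Nonempty a] {M : ℕ} {v : ℝ}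
    (hv : v ∈ metaConverseValues M W) {δ : ℝ} (hδ : 0 < δ) (hδ1 : δ ≤ 1) :
    ∃ ρ : Matrix a a ℂ, IsState ρ ∧ ∃ O ∈ effects (a × b),
      (∀ σ : Matrix b b ℂ, σ.PosSemidef → M * ((ρ ⊗ₖ σ) * O).trace.re ≤ σ.trace.re) ∧
      (channelState W ρ * O).trace.re = (1 - δ) * v := by
  obtain ⟨ρ, L, hρ, hL, hρL, hM, rfl⟩ := hv
  -- √ρ may be singular, so ρ is mixed with the maximally mixed τ. Scaling L by 1 - δ preserves the
  -- constraint, since ρ' ⊗ 1 - L' = (1 - δ)(ρ ⊗ 1 - L) + δ τ ⊗ 1.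
  set τ : Matrix a a ℂ := ((Fintype.card a : ℂ)⁻¹) • (1 : Matrix a a ℂ) with hτ
  have hτs : IsState τ := isState_maximallyMixed
  have hτp : τ.PosDef := Matrix.PosDef.one.smul (by
    have : (0 : ℝ) < (Fintype.card a : ℝ)⁻¹ := by
      have : 0 < Fintype.card a := Fintype.card_pos
      positivity
    simpa using Complex.zero_lt_real.2 this)
  have hδ' : (0 : ℂ) < (δ : ℂ) := by exact_mod_cast hδ
  have hδ1' : (0 : ℂ) ≤ ((1 - δ : ℝ) : ℂ) := by exact_mod_cast sub_nonneg.2 hδ1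
  set ρ' : Matrix a a ℂ := ((1 - δ : ℝ) : ℂ) • ρ + (δ : ℂ) • τ with hρ'
  have hρ's : IsState ρ' := by
    refine ⟨(hρ.1.smul hδ1').add (hτs.1.smul hδ'.le), ?_⟩
    rw [hρ', Matrix.trace_add, Matrix.trace_smul, Matrix.trace_smul, hρ.2, hτs.2]
    simp
  have hρ'p : ρ'.PosDef := Matrix.PosDef.posSemidef_add (hρ.1.smul hδ1') (hτp.smul hδ')
  have hunit : IsUnit (CFC.sqrt ρ') := by
    rw [CFC.isUnit_sqrt_iff ρ' (Matrix.nonneg_iff_posSemidef.2 hρ's.1)]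
    exact hρ'p.isUnit
  have hdet : IsUnit (CFC.sqrt ρ').det := (Matrix.isUnit_iff_isUnit_det _).1 hunit
  have hsq : CFC.sqrt ρ' * CFC.sqrt ρ' = ρ' :=
    CFC.sqrt_mul_sqrt_self ρ' (Matrix.nonneg_iff_posSemidef.2 hρ's.1)
  have hsH : (CFC.sqrt ρ')ᴴ = CFC.sqrt ρ' :=
    (Matrix.nonneg_iff_posSemidef.1 (CFC.sqrt_nonneg ρ')).isHermitian
  set S := CFC.sqrt ρ' ⊗ₖ (1 : Matrix b b ℂ) with hS
  set T := (CFC.sqrt ρ')⁻¹ ⊗ₖ (1 : Matrix b b ℂ) with hT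
  have hTH : Tᴴ = T := by
    rw [hT, Matrix.conjTranspose_kronecker, Matrix.conjTranspose_nonsing_inv, hsH,
      Matrix.conjTranspose_one]
  have hST : S * T = 1 := by
    rw [hS, hT, ← Matrix.mul_kronecker_mul, Matrix.mul_nonsing_inv _ hdet, Matrix.mul_one,
      Matrix.one_kronecker_one]
  have hTS : T * S = 1 := by
    rw [hS, hT, ← Matrix.mul_kronecker_mul, Matrix.nonsing_inv_mul _ hdet, Matrix.mul_one,
      Matrix.one_kronecker_one]
  have hTρT : T * (ρ' ⊗ₖ (1 : Matrix b b ℂ)) * T = 1 := by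
    have h1 : ρ' ⊗ₖ (1 : Matrix b b ℂ) = S * S := by
      rw [hS, ← Matrix.mul_kronecker_mul, hsq, Matrix.mul_one]
    rw [h1, ← Matrix.mul_assoc, hTS, Matrix.one_mul, hST]
  set L' := ((1 - δ : ℝ) : ℂ) • L with hL'
  have hL'p : L'.PosSemidef := hL.smul hδ1'
  have hSTS : S * (T * L' * T) * S = L' := by
    calc S * (T * L' * T) * S = (S * T) * L' * (T * S) := by simp only [Matrix.mul_assoc]
      _ = L' := by rw [hST, hTS, Matrix.one_mul, Matrix.mul_one]
  refine ⟨ρ', hρ's, T * L' * T, ⟨?_, ?_⟩, ?_, ?_⟩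
  · have := hL'p.mul_mul_conjTranspose_same T
    rwa [hTH] at this
  · have h1 : (ρ' ⊗ₖ (1 : Matrix b b ℂ) - L').PosSemidef := by
      have h2 := (hρL.smul hδ1').add
        ((hτs.1.kronecker (Matrix.PosSemidef.one (n := b) (R := ℂ))).smul hδ'.le)
      convert h2 using 1
      rw [hρ', hL', Matrix.add_kronecker, Matrix.smul_kronecker, Matrix.smul_kronecker, smul_sub]
      abel
    have := h1.mul_mul_conjTranspose_same T
    rwa [hTH, Matrix.mul_sub, Matrix.sub_mul, hTρT] at this
  · intro σ hσ
    rw [trace_kronecker_mul hρ's.1, ← hS, hSTS, hL', Matrix.mul_smul, Matrix.trace_smul,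
      smul_eq_mul, Complex.re_ofReal_mul]
    have h1 := (one_sub_smul_ptr_posSemidef_iff hL M).1 hM σ hσ
    have h2 := trace_re_nonneg hσ
    have h3 : (M : ℝ) * ((1 - δ) * (((1 : Matrix a a ℂ) ⊗ₖ σ) * L).trace.re) =
      (1 - δ) * (M * (((1 : Matrix a a ℂ) ⊗ₖ σ) * L).trace.re) := by ring
    rw [h3]
    nlinarith [mul_le_mul_of_nonneg_left h1 (sub_nonneg.2 hδ1)]
  · rw [trace_channelState_mul, ← hS, hSTS, hL', Matrix.mul_smul, Matrix.trace_smul,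
      smul_eq_mul, Complex.re_ofReal_mul]

end Sqrt

end Primal

/-! ### Both meta-converse formulas through minimax -/

section MetaConverse

variable [Fintype a] [Fintype b]

theorem continuous_trace_mul_re {n : Type*} [Fintype n] (X : Matrix n n ℂ) :
    Continuous fun O : Matrix n n ℂ => (X * O).trace.re :=
  Complex.continuous_re.comp (by fun_prop)

theorem trace_mul_smul_add_smul_re {n : Type*} [Fintype n] (X O O' : Matrix n n ℂ) (r r' : ℝ) :
    (X * (r • O + r' • O')).trace.re = r * (X * O).trace.re + r' * (X * O').trace.re := by
  rw [Matrix.mul_add, Matrix.mul_smul, Matrix.mul_smul, Matrix.trace_add, Matrix.trace_smul,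
    Matrix.trace_smul, Complex.add_re, Complex.smul_re, Complex.smul_re, smul_eq_mul, smul_eq_mul]

theorem trace_kronecker_smul_add_smul_re (ρ : Matrix a a ℂ) (Z Z' : Matrix b b ℂ)
    (O : Matrix (a × b) (a × b) ℂ) (r r' : ℝ) :
    ((ρ ⊗ₖ (r • Z + r' • Z')) * O).trace.re =
      r * ((ρ ⊗ₖ Z) * O).trace.re + r' * ((ρ ⊗ₖ Z') * O).trace.re := by
  rw [Matrix.kronecker_add, Matrix.kronecker_smul, Matrix.kronecker_smul,
    Matrix.trace_mul_comm, trace_mul_smul_add_smul_re, Matrix.trace_mul_comm O,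
    Matrix.trace_mul_comm O]

theorem trace_smul_add_smul_re {n : Type*} [Fintype n] (Z Z' : Matrix n n ℂ) (r r' : ℝ) :
    (r • Z + r' • Z').trace.re = r * Z.trace.re + r' * Z'.trace.re := by
  rw [Matrix.trace_add, Matrix.trace_smul, Matrix.trace_smul, Complex.add_re, Complex.smul_re,
    Complex.smul_re, smul_eq_mul, smul_eq_mul]

theorem convex_isState : Convex ℝ {σ : Matrix b b ℂ | IsState σ} := by
  intro σ hσ τ hτ r s hr hs hrs
  refine ⟨convex_posSemidef hσ.1 hτ.1 hr hs hrs, ?_⟩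
  rw [Matrix.trace_add, Matrix.trace_smul, Matrix.trace_smul, hσ.2, hτ.2, Complex.real_smul,
    Complex.real_smul, mul_one, mul_one]
  exact_mod_cast hrs

variable [DecidableEq a]

theorem nonempty_of_isQuantumChannel [Nonempty a] {W : Matrix a a ℂ →ₗ[ℂ] Matrix b b ℂ}
    (hW : IsQuantumChannel W) : Nonempty b := by
  by_contra hb
  rw [not_nonempty_iff] at hb
  have h := hW.tracePreserving 1
  rw [Matrix.trace_one, Matrix.trace, Finset.univ_eq_empty, Finset.sum_empty] at h
  exact Fintype.card_ne_zero (α := a) (by exact_mod_cast h.symm)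

variable [DecidableEq b]

/-- A bound on all states extends by homogeneity to all positive semidefinite matrices. -/
theorem forall_posSemidef_of_forall_isState {ρ : Matrix a a ℂ} {O : Matrix (a × b) (a × b) ℂ}
    {t : ℝ} (h : ∀ σ : Matrix b b ℂ, IsState σ → ((ρ ⊗ₖ σ) * O).trace.re ≤ t)
    (σ : Matrix b b ℂ) (hσ : σ.PosSemidef) : ((ρ ⊗ₖ σ) * O).trace.re ≤ t * σ.trace.re := by
  have him : σ.trace = (σ.trace.re : ℂ) := by
    refine Complex.ext (by simp) ?_
    simpa using (Complex.le_def.1 hσ.trace_nonneg).2.symm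
  rcases (trace_re_nonneg hσ).eq_or_lt with h0 | h0
  · have : σ = 0 := by
      rw [← hσ.trace_eq_zero_iff, him, ← h0, Complex.ofReal_zero]
    subst this
    simp
  · have hst : IsState ((σ.trace.re⁻¹ : ℝ) • σ) := by
      refine ⟨?_, ?_⟩
      · have := hσ.smul (a := ((σ.trace.re⁻¹ : ℝ) : ℂ)) (by exact_mod_cast inv_nonneg.2 h0.le)
        rwa [Complex.coe_smul] at this
      · rw [Matrix.trace_smul]
        nth_rw 2 [him]
        rw [Complex.real_smul, ← Complex.ofReal_mul, inv_mul_cancel₀ h0.ne', Complex.ofReal_one]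
    have := h _ hst
    rw [Matrix.kronecker_smul, Matrix.smul_mul, Matrix.trace_smul, Complex.smul_re, smul_eq_mul,
      inv_mul_le_iff₀ h0] at this
    linarith

variable {W : Matrix a a ℂ →ₗ[ℂ] Matrix b b ℂ}

/-- The optimal value of the semidefinite program of the meta-converse. -/
def metaConverseValue (M : ℕ) (W : Matrix a a ℂ →ₗ[ℂ] Matrix b b ℂ) : ℝ :=
  sSup (metaConverseValues M W)

theorem le_metaConverseValue (hW : IsQuantumChannel W) {M : ℕ} {v : ℝ}
    (hv : v ∈ metaConverseValues M W) : v ≤ metaConverseValue M W :=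
  le_csSup (bddAbove_metaConverseValues hW M) hv

theorem iInf_iSup_opMin_eq [Nonempty a] (hW : IsQuantumChannel W) (M : ℕ) :
    ⨅ (ρ : Matrix a a ℂ) (_ : IsState ρ), ⨆ (Z : Matrix b b ℂ) (_ : Z.PosSemidef),
      (((opMin (channelState W ρ) ((M : ℂ) • (ρ ⊗ₖ Z))).trace.re - Z.trace.re : ℝ) : EReal) =
    ((1 - metaConverseValue M W : ℝ) : EReal) := by
  have hherm : ∀ (ρ : Matrix a a ℂ), IsState ρ → ∀ Z : Matrix b b ℂ, Z.PosSemidef →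
      (channelState W ρ - (M : ℂ) • (ρ ⊗ₖ Z)).IsHermitian := fun ρ hρ Z hZ =>
    (channelState_posSemidef hW ρ).isHermitian.sub
      ((hρ.1.kronecker hZ).smul (a := (M : ℂ)) (by positivity)).isHermitian
  have hsm : ∀ (ρ : Matrix a a ℂ) (Z : Matrix b b ℂ) (O : Matrix (a × b) (a × b) ℂ),
      (((M : ℂ) • (ρ ⊗ₖ Z)) * O).trace.re = M * ((ρ ⊗ₖ Z) * O).trace.re := fun ρ Z O => by
    rw [Matrix.smul_mul, Matrix.trace_smul, smul_eq_mul, ← Complex.ofReal_natCast,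
      Complex.re_ofReal_mul]
  have htr : ∀ ρ : Matrix a a ℂ, IsState ρ → (channelState W ρ).trace.re = 1 := fun ρ hρ => by
    rw [trace_channelState hW hρ, Complex.one_re]
  refine le_antisymm ?_ (le_iInf₂ fun ρ hρ => ?_)
  · have key : ∀ v ∈ metaConverseValues M W, ∀ δ : ℝ, 0 < δ → δ ≤ 1 →
        ⨅ (ρ : Matrix a a ℂ) (_ : IsState ρ), ⨆ (Z : Matrix b b ℂ) (_ : Z.PosSemidef),
          (((opMin (channelState W ρ) ((M : ℂ) • (ρ ⊗ₖ Z))).trace.re - Z.trace.re : ℝ) : EReal) ≤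
        ((1 - (1 - δ) * v : ℝ) : EReal) := by
      intro v hv δ hδ hδ1
      obtain ⟨ρ, hρ, O, hO, hfeas, hval⟩ := exists_effect_of_mem_metaConverseValues hv hδ hδ1
      refine (iInf₂_le ρ hρ).trans (iSup₂_le fun Z hZ => ?_)
      have h1 := trace_opMin_le (hherm ρ hρ Z hZ) hO
      rw [htr ρ hρ, hval, hsm] at h1
      have h2 := hfeas Z hZ
      exact EReal.coe_le_coe_iff.2 (by linarith)
    refine EReal.le_of_forall_lt_iff_le.1 fun c hc => ?_
    have hc' : 1 - c < metaConverseValue M W := by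
      have := EReal.coe_lt_coe_iff.1 hc
      linarith
    obtain ⟨v, hv, hcv⟩ := exists_lt_of_lt_csSup ⟨0, zero_mem_metaConverseValues M⟩ hc'
    have hv1 := le_one_of_mem_metaConverseValues hW hv
    have hv0 := nonneg_of_mem_metaConverseValues hW hv
    -- Since v ≤ 1, losing a factor 1 - δ costs at most δ, which fits into the gap v - (1 - c).
    have hδ : 0 < min 1 (v - (1 - c)) := lt_min one_pos (by linarith)
    refine (key v hv _ hδ (min_le_left _ _)).trans (EReal.coe_le_coe_iff.2 ?_)
    nlinarith [min_le_right (1 : ℝ) (v - (1 - c))]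
  · by_contra! hlt
    obtain ⟨v, hv1, hv2⟩ := EReal.lt_iff_exists_real_btwn.1 hlt
    have hv2' := EReal.coe_lt_coe_iff.1 hv2
    obtain ⟨w, hvw, hw⟩ := exists_between hv2'
    set X := channelState W ρ
    -- The compact side of the minimax is the set of tests; the cone of Z need not be compact. The
    -- room between `v` and `w` pays for the loss in the minimax principle.
    obtain ⟨O, hO, hOw⟩ := exists_forall_le_of_forall_exists_le (K := effects (a × b))
      (C := {Z : Matrix b b ℂ | Z.PosSemidef}) isCompact_effects ⟨0, .zero⟩
      (fun O Z => 1 - (X * O).trace.re + M * ((ρ ⊗ₖ Z) * O).trace.re - Z.trace.re)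
      (fun Z _ => by
        have h1 := continuous_trace_mul_re X
        have h2 := continuous_trace_mul_re (ρ ⊗ₖ Z)
        fun_prop)
      (fun Z _ => ⟨convex_effects, fun O _ O' _ r r' _ _ hr => le_of_eq (by
        simp only [trace_mul_smul_add_smul_re, smul_eq_mul]
        linear_combination (-1 + Z.trace.re) * hr)⟩)
      (fun O _ => ⟨convex_posSemidef, fun Z _ Z' _ r r' _ _ hr => le_of_eq (by
        simp only [trace_kronecker_smul_add_smul_re, trace_smul_add_smul_re, smul_eq_mul]
        linear_combination (1 - (X * O).trace.re) * hr)⟩)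
      hvw (fun Z hZ => by
        obtain ⟨O, hO, h⟩ := exists_trace_opMin_eq (hherm ρ hρ Z hZ)
        refine ⟨O, hO, ?_⟩
        have h1 := (le_iSup₂ (f := fun (Z : Matrix b b ℂ) (_ : Z.PosSemidef) =>
          (((opMin (channelState W ρ) ((M : ℂ) • (ρ ⊗ₖ Z))).trace.re - Z.trace.re : ℝ) : EReal))
          Z hZ).trans hv1.le
        have h2 := EReal.coe_le_coe_iff.1 h1
        rw [h, htr ρ hρ, hsm] at h2
        exact h2)
    have hmem : (X * O).trace.re ∈ metaConverseValues M W := by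
      refine mem_metaConverseValues_of_effect hρ hO fun σ hσ => ?_
      by_contra! hgt
      set η := M * ((ρ ⊗ₖ σ) * O).trace.re - σ.trace.re with hη
      have hη0 : 0 < η := sub_pos.2 hgt
      -- A σ violating the type-II bound by η > 0 can be scaled up until the objective exceeds `w`.
      set r : ℝ := (|w| + |1 - (X * O).trace.re| + 1) / η
      have hr : 0 ≤ r := by positivity
      have hrσ : (r • σ).PosSemidef := by
        have := hσ.smul (a := (r : ℂ)) (by exact_mod_cast hr)
        simpa using this
      have h1 := hOw _ hrσ
      rw [Matrix.kronecker_smul, Matrix.smul_mul, Matrix.trace_smul, Matrix.trace_smul,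
        Complex.smul_re, Complex.smul_re, smul_eq_mul, smul_eq_mul] at h1
      have h2 : r * η = |w| + |1 - (X * O).trace.re| + 1 := div_mul_cancel₀ _ hη0.ne'
      rw [hη] at h2
      have h3 := le_abs_self w
      have h4 := neg_abs_le (1 - (X * O).trace.re)
      nlinarith
    have h0 := hOw 0 .zero
    have := le_metaConverseValue hW hmem
    simp only [Matrix.kronecker_zero, Matrix.zero_mul, Matrix.trace_zero, Complex.zero_re,
      mul_zero, add_zero, sub_zero] at h0
    linarith

theorem log_le_hypothesisTestingEntropy {n : Type*} [Fintype n] [DecidableEq n] {M : ℕ}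
    (hM : 1 ≤ M) {ε : ℝ} {X Y O : Matrix n n ℂ} (hO : O ∈ effects n)
    (hX : 1 - ε ≤ (X * O).trace.re) (hY : M * (Y * O).trace.re ≤ 1) :
    ((Real.log M : ℝ) : EReal) ≤ hypothesisTestingEntropy ε X Y := by
  have hM0 : (0 : ℝ) < M := by exact_mod_cast hM
  have h1 : (Y * O).trace.re ≤ (M : ℝ)⁻¹ := by
    rwa [← one_div, le_div_iff₀ hM0, mul_comm]
  have h2 : (⨅ (O : Matrix n n ℂ) (_ : O.PosSemidef ∧ (1 - O).PosSemidef ∧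
      1 - ε ≤ (X * O).trace.re), ENNReal.ofReal (Y * O).trace.re) ≤ ENNReal.ofReal (M : ℝ)⁻¹ :=
    (iInf₂_le O ⟨hO.1, hO.2, hX⟩).trans (ENNReal.ofReal_le_ofReal h1)
  have h3 := ENNReal.log_le_log h2
  rw [ENNReal.log_ofReal_of_pos (inv_pos.2 hM0), Real.log_inv, EReal.coe_neg] at h3
  exact EReal.le_neg_of_le_neg h3

/-- Strictness yields an actual test without showing that the infimum is attained. -/
theorem exists_effect_of_log_lt_hypothesisTestingEntropy {n : Type*} [Fintype n] [DecidableEq n]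
    {c ε : ℝ} {X Y : Matrix n n ℂ} (h : ((c : ℝ) : EReal) < hypothesisTestingEntropy ε X Y) :
    ∃ O ∈ effects n, 1 - ε ≤ (X * O).trace.re ∧ (Y * O).trace.re ≤ Real.exp (-c) := by
  have h1 := EReal.lt_neg_comm.1 h
  rw [← EReal.coe_neg, ← Real.log_exp (-c), ← ENNReal.log_ofReal_of_pos (Real.exp_pos _),
    ENNReal.log_lt_log_iff] at h1
  simp only [iInf_lt_iff] at h1
  obtain ⟨O, ⟨hO, hO', hX⟩, hlt⟩ := h1
  exact ⟨O, ⟨hO, hO'⟩, hX, ((ENNReal.ofReal_lt_ofReal_iff (Real.exp_pos _)).1 hlt).le⟩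

theorem epsMC_eq [Nonempty a] (hW : IsQuantumChannel W) {M : ℕ} (hM : 1 ≤ M) :
    epsMC M W = ((1 - metaConverseValue M W : ℝ) : EReal) := by
  have hM0 : (0 : ℝ) < M := by exact_mod_cast hM
  refine le_antisymm ?_ (le_iInf₂ fun ε hε => ?_)
  · refine EReal.le_of_forall_lt_iff_le.1 fun c hc => ?_
    have hc' : 1 - c < metaConverseValue M W := by
      have := EReal.coe_lt_coe_iff.1 hc
      linarith
    obtain ⟨v, hv, hcv⟩ := exists_lt_of_lt_csSup ⟨0, zero_mem_metaConverseValues M⟩ hc'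
    have hv1 := le_one_of_mem_metaConverseValues hW hv
    have hv0 := nonneg_of_mem_metaConverseValues hW hv
    set δ := min 1 (v - (1 - c)) with hδdef
    have hδ : 0 < δ := lt_min one_pos (by linarith)
    have hδ1 : δ ≤ 1 := min_le_left _ _
    have hδ2 : δ ≤ v - (1 - c) := min_le_right _ _
    obtain ⟨ρ, hρ, O, hO, hfeas, hval⟩ := exists_effect_of_mem_metaConverseValues hv hδ hδ1
    refine (iInf₂_le (1 - (1 - δ) * v) ⟨by nlinarith, by nlinarith, ?_⟩).trans
      (EReal.coe_le_coe_iff.2 (by nlinarith))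
    refine le_trans ?_ (le_iSup₂ (f := fun (ρ : Matrix a a ℂ) (_ : IsState ρ) =>
      ⨅ (σ : Matrix b b ℂ) (_ : IsState σ),
        hypothesisTestingEntropy (1 - (1 - δ) * v) (channelState W ρ) (ρ ⊗ₖ σ)) ρ hρ)
    refine le_iInf₂ fun σ hσ => ?_
    refine log_le_hypothesisTestingEntropy hM hO (by rw [hval]; linarith) ?_
    have := hfeas σ hσ.1
    rwa [hσ.2, Complex.one_re] at this
  · obtain ⟨hε0, hε1, hlog⟩ := hε
    -- One δ makes the inequality with log M strict, the other pays for the minimax. The state may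
    -- depend on δ, so no limit of states is needed.
    have key : ∀ δ : ℝ, 0 < δ → 1 - ε ≤ Real.exp (2 * δ) * metaConverseValue M W := by
      intro δ hδ
      have hlt : ((Real.log M - δ : ℝ) : EReal) < ((Real.log M : ℝ) : EReal) :=
        EReal.coe_lt_coe_iff.2 (by linarith)
      obtain ⟨ρ, hρ, hlt'⟩ := by simpa only [lt_iSup_iff] using hlt.trans_le hlog
      set X := channelState W ρ
      have hbnonempty := nonempty_of_isQuantumChannel hW
      obtain ⟨O, ⟨hO, hXO⟩, hOw⟩ := exists_forall_le_of_forall_exists_le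
        (K := effects (a × b) ∩ {O | 1 - ε ≤ (X * O).trace.re})
        (C := {σ : Matrix b b ℂ | IsState σ})
        (isCompact_effects.inter_right
          (isClosed_le continuous_const (continuous_trace_mul_re X)))
        ⟨_, isState_maximallyMixed⟩
        (fun O σ => ((ρ ⊗ₖ σ) * O).trace.re)
        (fun σ _ => continuous_trace_mul_re _)
        (fun σ _ => ⟨convex_effects.inter fun O hO O' hO' r r' hr hr' hrr => by
          have h1 : 1 - ε ≤ (X * O).trace.re := hO
          have h2 : 1 - ε ≤ (X * O').trace.re := hO'
          change 1 - ε ≤ (X * (r • O + r' • O')).trace.re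
          rw [trace_mul_smul_add_smul_re]
          calc 1 - ε = r * (1 - ε) + r' * (1 - ε) := by rw [← add_mul, hrr, one_mul]
            _ ≤ _ := add_le_add (mul_le_mul_of_nonneg_left h1 hr)
              (mul_le_mul_of_nonneg_left h2 hr'),
          fun O _ O' _ r r' _ _ _ => (trace_mul_smul_add_smul_re _ _ _ _ _).le⟩)
        (fun O _ => ⟨convex_isState, fun σ _ τ _ r r' _ _ _ =>
          (trace_kronecker_smul_add_smul_re _ _ _ _ _ _).ge⟩)
        (v := Real.exp (-(Real.log M - δ))) (w := Real.exp (-(Real.log M - 2 * δ)))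
        (Real.exp_lt_exp.2 (by linarith)) (fun σ hσ => by
          obtain ⟨O, hO, hX, hY⟩ := exists_effect_of_log_lt_hypothesisTestingEntropy
            (hlt'.trans_le (iInf₂_le σ hσ))
          exact ⟨O, ⟨hO, hX⟩, hY⟩)
      have hexp : Real.exp (-(Real.log M - 2 * δ)) = Real.exp (2 * δ) / M := by
        rw [neg_sub, Real.exp_sub, Real.exp_log hM0]
      rw [hexp] at hOw
      have hfeas := forall_posSemidef_of_forall_isState hOw
      -- Shrinking the test by e^(-2δ) restores type-II error at most 1/M and costs the same factor
      -- in the objective.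
      set κ : ℝ := (Real.exp (2 * δ))⁻¹ with hκ
      have hκ0 : 0 < κ := inv_pos.2 (Real.exp_pos _)
      have hκ1 : κ ≤ 1 := inv_le_one_of_one_le₀ (Real.one_le_exp (by linarith))
      have hmem := mem_metaConverseValues_of_effect (W := W) (M := M) hρ (O := κ • O)
        (by
          have := convex_effects hO zero_mem_effects hκ0.le (sub_nonneg.2 hκ1) (by ring)
          rwa [smul_zero, add_zero] at this)
        (fun σ hσ => by
          have h1 := hfeas σ hσ
          rw [Matrix.mul_smul, Matrix.trace_smul, Complex.smul_re, smul_eq_mul]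
          have h2 := mul_le_mul_of_nonneg_left h1 (mul_nonneg hM0.le hκ0.le)
          have h3 : (M * κ) * (Real.exp (2 * δ) / M * σ.trace.re) = σ.trace.re := by
            rw [hκ]
            field_simp
          linarith)
      have hle := le_metaConverseValue hW hmem
      rw [Matrix.mul_smul, Matrix.trace_smul, Complex.smul_re, smul_eq_mul, hκ,
        inv_mul_le_iff₀ (Real.exp_pos _)] at hle
      exact le_trans hXO hle
    have hlim : Tendsto (fun δ : ℝ => Real.exp (2 * δ) * metaConverseValue M W) (𝓝[>] 0)
        (𝓝 (metaConverseValue M W)) := by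
      have hc : Continuous fun δ : ℝ => Real.exp (2 * δ) * metaConverseValue M W := by fun_prop
      have := hc.tendsto 0
      simp only [mul_zero, Real.exp_zero, one_mul] at this
      exact this.mono_left nhdsWithin_le_nhds
    have := ge_of_tendsto hlim (eventually_mem_nhdsWithin.mono fun δ hδ => key δ hδ)
    exact EReal.coe_le_coe_iff.2 (by linarith)

end MetaConverse

/-! ### Non-signaling codes as feasible points of a semidefinite program -/

section NonSignaling

variable [Fintype a] [Fintype b]

/-- The average, over the correctly decoded messages, of the blocks of a code. -/
def codeAverage (N : ℕ) (J : Matrix (Fin N × a × b × Fin N) (Fin N × a × b × Fin N) ℂ) :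
    Matrix (a × b) (a × b) ℂ :=
  (N : ℂ)⁻¹ • ∑ m, J.submatrix (fun p => (m, p.1, p.2, m)) fun p => (m, p.1, p.2, m)

/-- The constraints satisfied by the averages of non-signaling codes. -/
structure IsCodeFeasible [DecidableEq b] (N : ℕ) (ρ : Matrix a a ℂ)
    (L : Matrix (a × b) (a × b) ℂ) : Prop where
  isState : IsState ρ
  posSemidef : L.PosSemidef
  le : (ρ ⊗ₖ (1 : Matrix b b ℂ) - L).PosSemidef
  ptr_eq : (N : ℂ) • ptr L = 1

/-- Only blocks sending message m to m contribute. The transpose comes from composing Choi matrices;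
it is harmless because the program is invariant under transposition. -/
theorem successProb_eq [DecidableEq a] (N : ℕ)
    (J : Matrix (Fin N × a × b × Fin N) (Fin N × a × b × Fin N) ℂ)
    (V : Matrix a a ℂ →ₗ[ℂ] Matrix b b ℂ) :
    successProb N J V = (choi V * (codeAverage N J)ᵀ).trace.re := by
  have h : (choi V * (codeAverage N J)ᵀ).trace = (N : ℂ)⁻¹ * ∑ m,
      effectiveChannel J V (Matrix.single m m 1) m m := by
    rw [codeAverage, Matrix.transpose_smul, Matrix.mul_smul, Matrix.trace_smul, smul_eq_mul,
      Matrix.transpose_sum, Matrix.mul_sum, Matrix.trace_sum]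
    congr 1
    refine Finset.sum_congr rfl fun m _ => ?_
    rw [effectiveChannel, Matrix.of_apply, Finset.sum_eq_single m, Finset.sum_eq_single m]
    · simp only [Matrix.trace, Matrix.diag_apply, Matrix.mul_apply, Fintype.sum_prod_type,
        choi_apply, Matrix.transpose_apply, Matrix.submatrix_apply, Matrix.single_apply_same,
        one_mul]
      refine Finset.sum_congr rfl fun s _ => ?_
      rw [Finset.sum_comm]
    · intro i _ hi
      simp [hi.symm]
    · simp
    · intro i _ hi
      simp [hi.symm]
    · simp
  rw [h, successProb, ← Complex.re_sum, ← Complex.ofReal_natCast, ← Complex.ofReal_inv,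
    Complex.re_ofReal_mul, one_div]

theorem IsNonSignaling.exists_isCodeFeasible [DecidableEq b] [Nonempty b] {N : ℕ} (hN : 1 ≤ N)
    {J : Matrix (Fin N × a × b × Fin N) (Fin N × a × b × Fin N) ℂ} (hJ : IsNonSignaling J) :
    ∃ ρ, IsCodeFeasible N ρ (codeAverage N J) := by
  obtain ⟨β⟩ := ‹Nonempty b›
  have hN0 : (N : ℂ) ≠ 0 := by exact_mod_cast (by omega : N ≠ 0)
  have hNinv : (0 : ℂ) ≤ (N : ℂ)⁻¹ := by positivity
  obtain ⟨K, hK⟩ := hJ.aliceToBob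
  obtain ⟨K', hK'⟩ := hJ.bobToAlice
  have h1 : ∀ m s r s' r', ∑ t, J (m, s, r, t) (m, s', r', t) =
      K' (m, s) (m, s') * (1 : Matrix b b ℂ) r r' := fun m s r s' r' =>
    congr_fun₂ hK' ((m, s), r) ((m, s'), r')
  have h2 : ∀ m r t r' t', ∑ s, J (m, s, r, t) (m, s, r', t') = K (r, t) (r', t') := by
    intro m r t r' t'
    have := congr_fun₂ hK (m, r, t) (m, r', t')
    simpa [traceAliceOut, Matrix.kroneckerMap_apply] using this
  have h3 : ∀ m r r', ∑ s, ∑ t, J (m, s, r, t) (m, s, r', t) = (1 : Matrix b b ℂ) r r' := by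
    intro m r r'
    have := congr_fun₂ hJ.tracePreserving (m, r) (m, r')
    simpa [traceOut, Matrix.one_apply] using this
  -- Alice's averaged output with Bob's input fixed at β. Non-signaling from Bob makes the choice of
  -- β immaterial.
  refine ⟨(N : ℂ)⁻¹ • ∑ m, ∑ t, J.submatrix (fun s => (m, s, β, t)) fun s => (m, s, β, t),
    ⟨?_, ?_⟩, ?_, ?_, ?_⟩
  · exact (Matrix.posSemidef_sum _ fun m _ => Matrix.posSemidef_sum _ fun t _ =>
      hJ.posSemidef.submatrix _).smul hNinv
  · rw [Matrix.trace_smul, Matrix.trace_sum]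
    have : ∀ m, (∑ t, J.submatrix (fun s => (m, s, β, t)) fun s => (m, s, β, t)).trace = 1 := by
      intro m
      have := h3 m β β
      rw [Matrix.one_apply_eq] at this
      rw [← this]
      simp [Matrix.trace, Matrix.sum_apply]
    simp [this, hN0]
  · exact (Matrix.posSemidef_sum _ fun m _ => hJ.posSemidef.submatrix _).smul hNinv
  · have : ((N : ℂ)⁻¹ • ∑ m, ∑ t, J.submatrix (fun s => (m, s, β, t)) fun s => (m, s, β, t)) ⊗ₖ
        (1 : Matrix b b ℂ) - codeAverage N J = (N : ℂ)⁻¹ • ∑ m, ∑ t ∈ Finset.univ.erase m,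
          J.submatrix (fun p : a × b => (m, p.1, p.2, t)) fun p => (m, p.1, p.2, t) := by
      ext ⟨s, r⟩ ⟨s', r'⟩
      simp only [codeAverage, Matrix.sub_apply, Matrix.kroneckerMap_apply, Matrix.smul_apply,
        Matrix.sum_apply, Matrix.submatrix_apply, smul_eq_mul, h1, Matrix.one_apply_eq, mul_one]
      rw [mul_assoc, ← mul_sub, Finset.sum_mul, ← Finset.sum_sub_distrib]
      congr 1
      refine Finset.sum_congr rfl fun m _ => ?_
      rw [← h1, ← Finset.add_sum_erase _ _ (Finset.mem_univ m), add_sub_cancel_left]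
    rw [this]
    exact (Matrix.posSemidef_sum _ fun m _ => Matrix.posSemidef_sum _ fun t _ =>
      hJ.posSemidef.submatrix _).smul hNinv
  · ext r r'
    simp only [Matrix.smul_apply, ptr, Matrix.of_apply, codeAverage, Matrix.sum_apply,
      Matrix.submatrix_apply, smul_eq_mul]
    -- Non-signaling from Alice makes Bob's marginal independent of m, so the sum over m = t is the
    -- full trace over t for one fixed message.
    rw [← Finset.mul_sum, mul_inv_cancel_left₀ hN0, Finset.sum_comm, ← h3 ⟨0, hN⟩ r r',
      Finset.sum_comm (s := (Finset.univ : Finset a))]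
    simp only [h2]

/-- A symmetric code: block L for the correct message, and ρ ⊗ 1 - L shared equally among the N - 1
wrong ones. The equality N · Tr_R L = 1 gives every block the marginal 1/N, so Bob learns nothing
about the message without the channel. -/
theorem IsCodeFeasible.exists_isNonSignaling [DecidableEq a] [DecidableEq b] {N : ℕ}
    (hN : 2 ≤ N) {ρ : Matrix a a ℂ} {L : Matrix (a × b) (a × b) ℂ} (h : IsCodeFeasible N ρ L) :
    ∃ J : Matrix (Fin N × a × b × Fin N) (Fin N × a × b × Fin N) ℂ,
      IsNonSignaling J ∧ codeAverage N J = L := by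
  have hN0 : (N : ℂ) ≠ 0 := by exact_mod_cast (by omega : N ≠ 0)
  have hN1 : ((N - 1 : ℕ) : ℂ) ≠ 0 := by exact_mod_cast (by omega : N - 1 ≠ 0)
  set A : Fin N × Fin N → Matrix (a × b) (a × b) ℂ := fun i =>
    if i.1 = i.2 then L else ((N - 1 : ℕ) : ℂ)⁻¹ • (ρ ⊗ₖ (1 : Matrix b b ℂ) - L) with hA
  have hApos : ∀ i, (A i).PosSemidef := by
    intro i
    simp only [hA]
    split_ifs
    · exact h.posSemidef
    · exact h.le.smul (by positivity)
  have hAsum : ∀ m, ∑ t, A (m, t) = ρ ⊗ₖ (1 : Matrix b b ℂ) := by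
    intro m
    rw [← Finset.add_sum_erase _ _ (Finset.mem_univ m), Finset.sum_congr rfl
      (g := fun _ => ((N - 1 : ℕ) : ℂ)⁻¹ • (ρ ⊗ₖ (1 : Matrix b b ℂ) - L)), Finset.sum_const,
      Finset.card_erase_of_mem (Finset.mem_univ m), Finset.card_univ, Fintype.card_fin,
      ← Nat.cast_smul_eq_nsmul ℂ, smul_smul, mul_inv_cancel₀ hN1, one_smul]
    · simp [hA]
    · intro t ht
      simp [hA, (Finset.ne_of_mem_erase ht).symm]
  have hAsum' : ∀ m p q, ∑ t, A (m, t) p q = (ρ ⊗ₖ (1 : Matrix b b ℂ)) p q := by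
    intro m p q
    rw [← hAsum m, Matrix.sum_apply]
  have htrρ : ∀ r r', ∑ s, (ρ ⊗ₖ (1 : Matrix b b ℂ)) (s, r) (s, r') =
      (1 : Matrix b b ℂ) r r' := by
    intro r r'
    have := h.isState.2
    rw [Matrix.trace] at this
    simp only [Matrix.diag_apply] at this
    exact (Finset.sum_mul Finset.univ (fun i => ρ i i) ((1 : Matrix b b ℂ) r r')).symm.trans
      (by rw [this, one_mul])
  have hL : ∀ r r', ∑ s, L (s, r) (s, r') = (N : ℂ)⁻¹ * (1 : Matrix b b ℂ) r r' := by
    intro r r'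
    rw [← h.ptr_eq, Matrix.smul_apply, smul_eq_mul, inv_mul_cancel_left₀ hN0]
    rfl
  have hAptr : ∀ i r r', ∑ s, A i (s, r) (s, r') = (N : ℂ)⁻¹ * (1 : Matrix b b ℂ) r r' := by
    intro i r r'
    simp only [hA]
    split_ifs
    · exact hL r r'
    · simp only [Matrix.smul_apply, Matrix.sub_apply, smul_eq_mul]
      rw [← Finset.mul_sum, Finset.sum_sub_distrib, htrρ, hL, Nat.cast_sub (by omega)]
      have : ((N : ℂ) - 1) ≠ 0 := by
        rwa [Nat.cast_sub (by omega), Nat.cast_one] at hN1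
      rw [Nat.cast_one]
      field_simp
  refine ⟨Matrix.of fun p q => if (p.1, p.2.2.2) = (q.1, q.2.2.2) then
    A (p.1, p.2.2.2) (p.2.1, p.2.2.1) (q.2.1, q.2.2.1) else 0, ⟨?_, ?_, ?_, ?_⟩, ?_⟩
  · exact posSemidef_ite_eq (fun p : Fin N × a × b × Fin N => (p.1, p.2.2.2))
      (fun p => (p.2.1, p.2.2.1)) hApos
  · ext ⟨m, r⟩ ⟨m', r'⟩
    simp only [traceOut, Matrix.of_apply, Prod.mk.injEq, and_true]
    by_cases hm : m = m'
    · subst hm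
      simp only [if_true, hAsum', htrρ]
      simp [Matrix.one_apply]
    · simp [hm]
  · refine ⟨(N : ℂ)⁻¹ • 1, ?_⟩
    ext ⟨m, r, t⟩ ⟨m', r', t'⟩
    simp only [traceAliceOut, Matrix.of_apply, Prod.mk.injEq, Matrix.kroneckerMap_apply,
      Matrix.smul_apply, smul_eq_mul]
    by_cases hm : m = m'
    · subst hm
      by_cases ht : t = t'
      · subst ht
        simp [hAptr, Matrix.one_apply]
      · simp [ht]
    · simp [hm]
  · refine ⟨(1 : Matrix (Fin N) (Fin N) ℂ) ⊗ₖ ρ, ?_⟩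
    ext ⟨⟨m, s⟩, r⟩ ⟨⟨m', s'⟩, r'⟩
    simp only [traceBobOut, Matrix.of_apply, Prod.mk.injEq, and_true, Matrix.kroneckerMap_apply]
    by_cases hm : m = m'
    · subst hm
      simp [hAsum', Matrix.kroneckerMap_apply]
    · simp [hm]
  · ext ⟨s, r⟩ ⟨s', r'⟩
    simp [codeAverage, Matrix.sum_apply, hA, hN0]

end NonSignaling

/-! ### Activation by a classical bit -/

section Bit

variable [Fintype a] [Fintype b]

/-- The compression of a matrix to equal values of the two bits, summed over these values. -/
def bitCompression {k : Type*} [Fintype k] (L : Matrix ((a × k) × (b × k)) ((a × k) × (b × k)) ℂ) :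
    Matrix (a × b) (a × b) ℂ :=
  ∑ i, L.submatrix (fun p => ((p.1, i), (p.2, i))) fun p => ((p.1, i), (p.2, i))

omit [Fintype a] [Fintype b] in
theorem bitCompression_transpose {k : Type*} [Fintype k]
    (L : Matrix ((a × k) × (b × k)) ((a × k) × (b × k)) ℂ) :
    bitCompression Lᵀ = (bitCompression L)ᵀ := by
  rw [bitCompression, bitCompression, Matrix.transpose_sum]
  rfl

theorem bitChannel_single (k k' l l' : Fin 2) :
    bitChannel (Matrix.single k k' 1) l l' = if k = k' ∧ k = l ∧ k = l' then 1 else 0 := by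
  simp only [bitChannel, LinearMap.coe_mk, AddHom.coe_mk, Fin.sum_univ_two]
  fin_cases k <;> fin_cases k' <;> fin_cases l <;> fin_cases l' <;> simp

omit [Fintype b] in
theorem tensorMap_single {c d : Type*} [Fintype c] [DecidableEq a] [DecidableEq c]
    (Φ : Matrix a a ℂ →ₗ[ℂ] Matrix b b ℂ) (Ψ : Matrix c c ℂ →ₗ[ℂ] Matrix d d ℂ)
    (s s' : a) (k k' : c) :
    tensorMap Φ Ψ (Matrix.single (s, k) (s', k') 1) =
      Φ (Matrix.single s s' 1) ⊗ₖ Ψ (Matrix.single k k' 1) := by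
  simp only [tensorMap, LinearMap.coe_mk, AddHom.coe_mk]
  rw [Finset.sum_eq_single s, Finset.sum_eq_single s', Finset.sum_eq_single k,
    Finset.sum_eq_single k'] <;>
    simp +contextual [Matrix.single_apply, eq_comm]

/-- The Choi matrix of the bit channel vanishes unless all four bit indices agree. -/
theorem trace_choi_tensorMap_bitChannel_mul [DecidableEq a] (W : Matrix a a ℂ →ₗ[ℂ] Matrix b b ℂ)
    (L : Matrix ((a × Fin 2) × (b × Fin 2)) ((a × Fin 2) × (b × Fin 2)) ℂ) :
    (choi (tensorMap W bitChannel) * L).trace = (choi W * bitCompression L).trace := by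
  simp only [Matrix.trace, Matrix.diag_apply, Matrix.mul_apply, Fintype.sum_prod_type, choi_apply,
    tensorMap_single, Matrix.kroneckerMap_apply, bitChannel_single, bitCompression,
    Fin.sum_univ_two, Matrix.add_apply, Matrix.submatrix_apply, mul_add, Finset.sum_add_distrib]
  simp

theorem IsCodeFeasible.trace_mem_metaConverseValues [DecidableEq a] [DecidableEq b] {M : ℕ}
    (hM : 1 ≤ M) {ρ : Matrix (a × Fin 2) (a × Fin 2) ℂ}
    {L : Matrix ((a × Fin 2) × (b × Fin 2)) ((a × Fin 2) × (b × Fin 2)) ℂ}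
    (h : IsCodeFeasible (2 * M) ρ L) (W : Matrix a a ℂ →ₗ[ℂ] Matrix b b ℂ) :
    (choi (tensorMap W bitChannel) * Lᵀ).trace.re ∈ metaConverseValues M W := by
  set ρ₁ : Matrix a a ℂ := ∑ i, ρ.submatrix (fun s => (s, i)) fun s => (s, i) with hρ₁
  have hM0 : (M : ℂ) ≠ 0 := by exact_mod_cast (by omega : M ≠ 0)
  have hpos : (bitCompression L).PosSemidef :=
    Matrix.posSemidef_sum _ fun i _ => h.posSemidef.submatrix _
  have hle : (ρ₁ ⊗ₖ (1 : Matrix b b ℂ) - bitCompression L).PosSemidef := by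
    have : ρ₁ ⊗ₖ (1 : Matrix b b ℂ) - bitCompression L =
        ∑ i, (ρ ⊗ₖ (1 : Matrix (b × Fin 2) (b × Fin 2) ℂ) - L).submatrix
          (fun p : a × b => ((p.1, i), (p.2, i))) fun p => ((p.1, i), (p.2, i)) := by
      ext ⟨s, r⟩ ⟨s', r'⟩
      simp [hρ₁, bitCompression, Matrix.sum_apply, Matrix.one_apply]
    rw [this]
    exact Matrix.posSemidef_sum _ fun i _ => h.le.submatrix _
  have hptr : (1 - (M : ℂ) • ptr (bitCompression L)).PosSemidef := by
    -- The slack is the weight of the blocks with unequal bits, hence positive.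
    have : 1 - (M : ℂ) • ptr (bitCompression L) =
        (M : ℂ) • ∑ s, ∑ i, ∑ j ∈ Finset.univ.erase i,
          L.submatrix (fun r : b => ((s, j), (r, i))) fun r => ((s, j), (r, i)) := by
      ext r r'
      have h1 : ∀ i, (2 * M : ℂ) * ∑ s, ∑ j, L ((s, j), (r, i)) ((s, j), (r', i)) =
          (1 : Matrix b b ℂ) r r' := by
        intro i
        have := congr_fun₂ h.ptr_eq (r, i) (r', i)
        simpa [ptr, Fintype.sum_prod_type, Matrix.one_apply] using this
      have h2 : (M : ℂ) * ∑ s, ∑ i, ∑ j, L ((s, j), (r, i)) ((s, j), (r', i)) =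
          (1 : Matrix b b ℂ) r r' := by
        rw [Finset.sum_comm, Fin.sum_univ_two]
        linear_combination (h1 0 + h1 1) / 2
      simp only [Matrix.sub_apply, ← h2, Matrix.smul_apply, ptr, Matrix.of_apply, bitCompression,
        Matrix.sum_apply, Matrix.submatrix_apply, smul_eq_mul]
      rw [← mul_sub, ← Finset.sum_sub_distrib]
      congr 1
      refine Finset.sum_congr rfl fun s _ => ?_
      rw [← Finset.sum_sub_distrib]
      refine Finset.sum_congr rfl fun i _ => ?_
      rw [← Finset.add_sum_erase _ _ (Finset.mem_univ i), add_sub_cancel_left]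
    rw [this]
    exact (Matrix.posSemidef_sum _ fun s _ => Matrix.posSemidef_sum _ fun i _ =>
      Matrix.posSemidef_sum _ fun j _ => h.posSemidef.submatrix _).smul (by positivity)
  refine ⟨ρ₁ᵀ, (bitCompression L)ᵀ, ⟨?_, ?_⟩, hpos.transpose, ?_, ?_, ?_⟩
  · exact (Matrix.posSemidef_sum _ fun i _ => h.isState.1.submatrix _).transpose
  · rw [Matrix.trace_transpose, ← h.isState.2]
    simp only [hρ₁, Matrix.trace, Matrix.diag_apply, Matrix.sum_apply, Matrix.submatrix_apply,
      Fintype.sum_prod_type]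
  · have := hle.transpose
    rwa [Matrix.transpose_sub, ← Matrix.kroneckerMap_transpose, Matrix.transpose_one] at this
  · have := hptr.transpose
    rwa [Matrix.transpose_sub, Matrix.transpose_one, Matrix.transpose_smul] at this
  · rw [trace_choi_tensorMap_bitChannel_mul, bitCompression_transpose]

/-- The slack G = 1/M - Tr_R L goes into the blocks with unequal bits as ρ ⊗ G, invisible to the bit
channel. Each output bit then sees Tr_R L + G = 1/M, and the uniform input bit contributes the
factor 1/2. -/
theorem exists_isCodeFeasible_of_posSemidef [DecidableEq a] [DecidableEq b] {M : ℕ}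
    (hM : 1 ≤ M) {ρ : Matrix a a ℂ} {L : Matrix (a × b) (a × b) ℂ} (hρ : IsState ρ)
    (hL : L.PosSemidef) (hρL : (ρ ⊗ₖ (1 : Matrix b b ℂ) - L).PosSemidef)
    (hptr : (1 - (M : ℂ) • ptr L).PosSemidef) :
    ∃ (ρ' : Matrix (a × Fin 2) (a × Fin 2) ℂ)
      (L' : Matrix ((a × Fin 2) × (b × Fin 2)) ((a × Fin 2) × (b × Fin 2)) ℂ),
      IsCodeFeasible (2 * M) ρ' L' ∧ bitCompression L' = L := by
  have hM0 : (M : ℂ) ≠ 0 := by exact_mod_cast (by omega : M ≠ 0)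
  have h2 : (0 : ℂ) ≤ 2⁻¹ := by positivity
  set G : Matrix b b ℂ := (M : ℂ)⁻¹ • (1 - (M : ℂ) • ptr L) with hG
  have hG' : G = (M : ℂ)⁻¹ • 1 - ptr L := by
    rw [hG, smul_sub, smul_smul, inv_mul_cancel₀ hM0, one_smul]
  have hGpos : G.PosSemidef := hptr.smul (by positivity)
  -- M ≥ 1 enters here: 1 - G = (1 - 1/M) 1 + Tr_R L, which keeps ρ ⊗ G below ρ ⊗ 1.
  have hGle : (1 - G).PosSemidef := by
    have h1 : (0 : ℂ) ≤ ((1 - (M : ℝ)⁻¹ : ℝ) : ℂ) := by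
      have : (M : ℝ)⁻¹ ≤ 1 := inv_le_one_of_one_le₀ (by exact_mod_cast hM)
      exact_mod_cast sub_nonneg.2 this
    have h3 := (Matrix.PosSemidef.one (n := b) (R := ℂ)).smul h1
    convert h3.add (ptr_posSemidef hL) using 1
    rw [hG']
    push_cast
    rw [sub_smul, one_smul]
    abel
  set A : Fin 2 × Fin 2 → Matrix (a × b) (a × b) ℂ := fun i =>
    if i.1 = i.2 then L else ρ ⊗ₖ G with hA
  have hApos : ∀ i, (A i).PosSemidef := by
    intro i
    simp only [hA]
    split_ifs
    · exact hL
    · exact hρ.1.kronecker hGpos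
  have hAle : ∀ i, (ρ ⊗ₖ (1 : Matrix b b ℂ) - A i).PosSemidef := by
    intro i
    simp only [hA]
    split_ifs
    · exact hρL
    · have := hρ.1.kronecker hGle
      have hsub : ρ ⊗ₖ (1 : Matrix b b ℂ) - ρ ⊗ₖ G = ρ ⊗ₖ (1 - G) := by
        ext ⟨s, r⟩ ⟨s', r'⟩
        simp only [Matrix.sub_apply, Matrix.kroneckerMap_apply]
        ring
      rwa [hsub]
  have hAptr : ∀ j r r', ∑ s, ∑ i, A (i, j) (s, r) (s, r') =
      (M : ℂ)⁻¹ * (1 : Matrix b b ℂ) r r' := by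
    intro j r r'
    have h1 : ∀ s, ∑ i, A (i, j) (s, r) (s, r') = L (s, r) (s, r') + ρ s s * G r r' := by
      intro s
      fin_cases j <;> simp [hA, Fin.sum_univ_two, add_comm]
    have h3 : ∑ s, ρ s s = 1 := hρ.2
    simp only [h1, Finset.sum_add_distrib, ← Finset.sum_mul, h3, one_mul, hG', Matrix.sub_apply,
      Matrix.smul_apply, smul_eq_mul, ptr, Matrix.of_apply]
    ring
  let g : (a × Fin 2) × (b × Fin 2) → Fin 2 × Fin 2 := fun p => (p.1.2, p.2.2)
  let f : (a × Fin 2) × (b × Fin 2) → a × b := fun p => (p.1.1, p.2.1)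
  refine ⟨ρ ⊗ₖ ((2 : ℂ)⁻¹ • (1 : Matrix (Fin 2) (Fin 2) ℂ)),
    (2 : ℂ)⁻¹ • Matrix.of fun p q => if g p = g q then A (g p) (f p) (f q) else 0,
    ⟨⟨hρ.1.kronecker (Matrix.PosSemidef.one.smul h2), ?_⟩,
      (posSemidef_ite_eq g f hApos).smul h2, ?_, ?_⟩, ?_⟩
  · rw [Matrix.trace_kronecker, hρ.2, Matrix.trace_smul, Matrix.trace_one]
    simp
  · convert (posSemidef_ite_eq g f hAle).smul h2 using 1
    ext ⟨⟨s, k⟩, ⟨r, l⟩⟩ ⟨⟨s', k'⟩, ⟨r', l'⟩⟩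
    simp only [Matrix.sub_apply, Matrix.kroneckerMap_apply, Matrix.smul_apply, Matrix.of_apply,
      smul_eq_mul, g, f, Matrix.one_apply, Prod.mk.injEq]
    by_cases hk : k = k' <;> by_cases hl : l = l' <;> by_cases hr : r = r' <;>
      simp [hk, hl, hr]
    ring
  · ext ⟨r, l⟩ ⟨r', l'⟩
    simp only [Matrix.smul_apply, ptr, Matrix.of_apply, smul_eq_mul, g, f, Prod.mk.injEq,
      Fintype.sum_prod_type, true_and]
    by_cases hl : l = l'
    · subst hl
      simp only [if_true, ← Finset.mul_sum, hAptr]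
      simp only [Matrix.one_apply, Prod.mk.injEq, and_true]
      push_cast
      field_simp
    · simp [hl]
  · ext ⟨s, r⟩ ⟨s', r'⟩
    simp only [bitCompression, Matrix.sum_apply, Matrix.submatrix_apply, Matrix.smul_apply,
      Matrix.of_apply, smul_eq_mul, g, f, hA, if_true, Fin.sum_univ_two]
    ring

theorem epsNS_eq [DecidableEq a] [DecidableEq b] [Nonempty a]
    {W : Matrix a a ℂ →ₗ[ℂ] Matrix b b ℂ} (hW : IsQuantumChannel W) {M : ℕ} (hM : 1 ≤ M) :
    epsNS (2 * M) (tensorMap W bitChannel) = ((1 - metaConverseValue M W : ℝ) : EReal) := by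
  have hb := nonempty_of_isQuantumChannel hW
  rw [epsNS, EReal.coe_sub, EReal.coe_one]
  congr 1
  refine le_antisymm (iSup₂_le fun J hJ => ?_) ?_
  · obtain ⟨ρ, hρ⟩ := hJ.exists_isCodeFeasible (by omega)
    rw [successProb_eq]
    exact EReal.coe_le_coe_iff.2
      (le_metaConverseValue hW (hρ.trace_mem_metaConverseValues hM W))
  · refine EReal.ge_of_forall_gt_iff_ge.1 fun c hc => ?_
    obtain ⟨v, ⟨ρ, L, hρ, hL, hρL, hptr, rfl⟩, hcv⟩ := exists_lt_of_lt_csSup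
      ⟨0, zero_mem_metaConverseValues M⟩ (EReal.coe_lt_coe_iff.1 hc)
    obtain ⟨ρ', L', hL', hcomp⟩ := exists_isCodeFeasible_of_posSemidef hM (ρ := ρᵀ) (L := Lᵀ)
      ⟨hρ.1.transpose, by rw [Matrix.trace_transpose, hρ.2]⟩ hL.transpose
      (by
        have := hρL.transpose
        rwa [Matrix.transpose_sub, ← Matrix.kroneckerMap_transpose, Matrix.transpose_one] at this)
      (by
        have := hptr.transpose
        rwa [Matrix.transpose_sub, Matrix.transpose_one, Matrix.transpose_smul] at this)
    -- The bit ensures 2M ≥ 2 messages, so a wrong message exists even for M = 1.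
    obtain ⟨J, hJ, hJL⟩ := hL'.exists_isNonSignaling (by omega)
    refine le_trans (EReal.coe_le_coe_iff.2 ?_) (le_iSup₂ (f := fun
      (J : Matrix (Fin (2 * M) × (a × Fin 2) × (b × Fin 2) × Fin (2 * M))
        (Fin (2 * M) × (a × Fin 2) × (b × Fin 2) × Fin (2 * M)) ℂ) (_ : IsNonSignaling J) =>
        (successProb (2 * M) J (tensorMap W bitChannel) : EReal)) J hJ)
    rw [successProb_eq, hJL, trace_choi_tensorMap_bitChannel_mul, bitCompression_transpose, hcomp,
      Matrix.transpose_transpose]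
    exact hcv.le

end Bit

end NSCoding

end

theorem mainTheorem8 {a b : Type*} [Fintype a] [Fintype b] [DecidableEq a] [DecidableEq b]
    [Nonempty a] (W : Matrix a a ℂ →ₗ[ℂ] Matrix b b ℂ) (hW : IsQuantumChannel W)
    (M : ℕ) (hM : 1 ≤ M) :
    epsNS (2 * M) (tensorMap W bitChannel) = epsMC M W ∧
    epsMC M W =
      ⨅ (ρ : Matrix a a ℂ) (_ : IsState ρ), ⨆ (Z : Matrix b b ℂ) (_ : Z.PosSemidef),
        (((opMin (channelState W ρ) ((M : ℂ) • (ρ ⊗ₖ Z))).trace.re - Z.trace.re : ℝ) :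
          EReal) := by
  exact ⟨(epsNS_eq hW hM).trans (epsMC_eq hW hM).symm,
    (epsMC_eq hW hM).trans (iInf_iSup_opMin_eq hW M).symm⟩
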